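/- Let $\kappa>0$ and let $\mathrm{EH}$ be the total space of the canonical line bundle of $\mathbb{CP}^1$: two copies of $\mathbb C^2$ with coordinates $(w,\zeta)$, glued along $w\neq 0$ by $(w,\zeta)\mapsto(1/w,\ \zeta w/\bar w)$. Put $a=\operatorname{Im}\big(\bar w\,dw/(1+|w|^2)\big)$, $\theta=d\zeta+2i\zeta a$, $s=|\zeta|$, $F=\sqrt{1+\kappa/s^2}$ (so $sF=\sqrt{\kappa+s^2}$ makes sense also at $s=0$), and $$e_1=(\kappa+s^2)^{1/4}\,\frac{dw}{1+|w|^2},\qquad e_2=\tfrac12(\kappa+s^2)^{-1/4}\,\theta .$$ Give $\mathrm{EH}$ the Eguchi--Hanson metric $g=|e_1|^2+|e_2|^2=(|\zeta|^2+\kappa)^{1/2}\frac{|dw|^2}{(1+|w|^2)^2}+\frac14(|\zeta|^2+\kappa)^{-1/2}|\theta|^2$ and its orientation as a complex surface. Away from the zero section $\mathbb{CP}^1=\{\zeta=0\}$ use the coordinates $(z_1,z_2)\in\mathbb C^2\setminus\{0\}$, defined up to a common sign by $(w,\zeta)=\big(z_1/z_2,\ (|z_1|^2+|z_2|^2)\,z_2/\bar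 z_2\big)$, in which $s=|z_1|^2+|z_2|^2$. 1. The form $$\tilde\omega=\frac{1}{(sF)^2}\,\frac i2\,(e_1\wedge\bar e_1-e_2\wedge\bar e_2)$$ is a well-defined smooth 2-form on $\mathrm{EH}$. It is closed, anti-self-dual and $L^2$, and $|\tilde\omega|^2=2(sF)^{-4}$, where $|\tilde\omega|^2\,\mathrm{vol}=\tilde\omega\wedge *\tilde\omega=-\tilde\omega\wedge\tilde\omega$. 2. Away from the zero section $$\tilde\omega=\frac i2\,d\beta,\qquad \beta=\frac{z_1\,d\bar z_1+z_2\,d\bar z_2}{F s^2}.$$ 3. Let $A=\dfrac{\sqrt\kappa}{2s^2F}(z_1\,d\bar z_1+z_2\,d\bar z_2)$. For every $c\in\mathbb C$ the form $d\big(c(\beta-\bar\beta)\big)$ extends uniquely to a smooth 2-form $\Omega$ on $\mathrm{EH}$, namely $\Omega=-4ic\,\tilde\omega$. For $\ell\in\mathbb Z$, $$\frac{i}{2\pi}\int_{\mathbb{CP}^1}\Omega=\ell\quad\Longleftrightarrow\quad c(\beta-\bar\beta)=\ell(A-\bar A),$$ and $\Omega$ is the curvature of a $U(1)$ connection on a Hermitian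 line bundle over $\mathrm{EH}$ if and only if $\frac{i}{2\pi}\int_{\mathbb{CP}^1}\Omega$ is an integer. For every $\ell\in\mathbb Z$ there is a Hermitian line bundle with $U(1)$ connection over $\mathrm{EH}$ whose pullback to $\mathbb C^2\setminus\{0\}$ under $(z_1,z_2)\mapsto(w,\zeta)$ has connection form $\mathcal A=\ell(A-\bar A)$ in a global unitary frame. 4. On $\mathbb C^2\setminus\{0\}$, $A=-\tfrac12\,\bar\partial\,\sinh^{-1}(\sqrt\kappa/s)$. -/

import Mathlib

open Complex MeasureTheory
open scoped ContDiff ComplexConjugate ENNReal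

noncomputable section

namespace EguchiHanson

/-! ### Differential forms on the real vector space `ℂ × ℂ` -/

/-- The model space `ℂ²`, regarded as a real four-dimensional space. -/
abbrev Model : Type := ℂ × ℂ

/-- Complex-valued real-linear forms on a tangent space. -/
abbrev Covector : Type := Model →L[ℝ] ℂ

/-- The wedge product of two covectors, see `wedge_apply` for the normalisation. -/
def wedge (α β : Covector) : Model [⋀^Fin 2]→L[ℝ] ℂ :=
  ContinuousMultilinearMap.alternatization
    ((ContinuousMultilinearMap.mkPiAlgebra ℝ (Fin 2) ℂ).compContinuousLinearMap ![α, β])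

theorem wedge_apply (α β : Covector) (u v : Model) :
    wedge α β ![u, v] = α u * β v - α v * β u := by
  have h : (Finset.univ : Finset (Equiv.Perm (Fin 2))) = {1, Equiv.swap 0 1} := by decide
  rw [wedge, ContinuousMultilinearMap.alternatization_apply_apply, h,
    Finset.sum_pair (by decide)]
  simp [Fin.prod_univ_two, sub_eq_add_neg]

/-- The complex conjugate of a covector. -/
def conjForm (α : Covector) : Covector := (conjCLE : ℂ →L[ℝ] ℂ) ∘L α

/-- The exterior derivative of a 1-form on (an open part of) `ℂ²`. -/
def d₁ (α : Model → Covector) : Model → Model [⋀^Fin 2]→L[ℝ] ℂ :=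
  extDeriv fun p => ContinuousAlternatingMap.ofSubsingleton ℝ Model ℂ (0 : Fin 1) (α p)

/-- `∂̄ f`, the `(0,1)`-part of `df`, for a function on (an open part of) `ℂ²` with its standard
complex structure: `v ↦ (df(v) + i df(iv)) / 2`. -/
def dbar (f : Model → ℂ) (z : Model) : Covector :=
  (1 / 2 : ℂ) • (fderiv ℝ f z +
    I • (fderiv ℝ f z ∘L ((I • ContinuousLinearMap.id ℂ Model).restrictScalars ℝ)))

/-! ### The four-manifold

The Eguchi-Hanson manifold is the total space of the canonical line bundle of `ℂP¹`. It is covered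
by two bundle charts with values in `ℂ × ℂ`, with coordinates `(w, ζ)`: here `w` is an inhomogeneous
coordinate on `ℂP¹` and `ζ` is the fibre coordinate with respect to a unitary frame (so that the
charts are smooth, but not holomorphic in `w`). -/

/-- The change of bundle charts, `(w, ζ) ↦ (1 / w, ζ w / w̄)`, on the overlap `w ≠ 0`. -/
def transition (p : Model) : Model := (p.1⁻¹, p.2 * (p.1 / conj p.1))

theorem transition_transition {p : Model} (hp : p.1 ≠ 0) : transition (transition p) = p := by
  have h : conj p.1 ≠ 0 := by simpa using hp
  ext1
  · simp [transition]
  · simp only [transition, map_inv₀]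
    field_simp

/-- Two labelled chart points describe the same point of the manifold. -/
def gluing : Setoid (Fin 2 × Model) where
  r x y := x = y ∨ (x.1 ≠ y.1 ∧ x.2.1 ≠ 0 ∧ y.2 = transition x.2)
  iseqv := by
    have hne : ∀ {p : Model}, p.1 ≠ 0 → (transition p).1 ≠ 0 := fun h => by
      simpa [transition] using h
    refine ⟨fun x => Or.inl rfl, ?_, ?_⟩
    · rintro x y (h | ⟨h1, h2, h3⟩)
      · exact Or.inl h.symm
      · exact Or.inr ⟨h1.symm, h3 ▸ hne h2, by rw [h3, transition_transition h2]⟩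
    · rintro x y z (rfl | ⟨h1, h2, h3⟩) (rfl | ⟨k1, k2, k3⟩)
      · exact Or.inl rfl
      · exact Or.inr ⟨k1, k2, k3⟩
      · exact Or.inr ⟨h1, h2, h3⟩
      · refine Or.inl (Prod.ext ?_ ?_)
        · omega
        · rw [k3, h3, transition_transition h2]

/-- The Eguchi-Hanson manifold: two copies of `ℂ²` glued along `w ≠ 0`. -/
def EH : Type := Quotient gluing

instance : TopologicalSpace EH := inferInstanceAs (TopologicalSpace (Quotient gluing))

instance : MeasurableSpace EH := borel EH

instance : BorelSpace EH := ⟨rfl⟩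

/-- The (inverse) bundle charts `ℂ² → EH`. -/
def chart (i : Fin 2) (p : Model) : EH := Quotient.mk gluing (i, p)

/-- The function `s = |ζ|` on the manifold. -/
def s : EH → ℝ := Quotient.lift (fun x : Fin 2 × Model => ‖x.2.2‖) <| by
  rintro x y (rfl | ⟨-, h2, h3⟩)
  · rfl
  · have : ‖x.2.1‖ ≠ 0 := by simpa using h2
    simp [h3, transition, div_self this]

/-- The function `s F = √(κ + s²)`, where `F = √(1 + κ / s²)`. In this form it makes sense on the
zero section `s = 0` as well. -/
def sF (κ : ℝ) (x : EH) : ℝ := √(κ + s x ^ 2)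

/-- A smooth complex-valued `k`-form on the manifold, given by its expressions in the two bundle
charts, which have to agree on the overlap. -/
@[ext]
structure Form (k : ℕ) where
  /-- The expression of the form in the `i`-th chart. -/
  expr : Fin 2 → Model → Model [⋀^Fin k]→L[ℝ] ℂ
  smooth : ∀ i, ContDiff ℝ ∞ (expr i)
  compat : ∀ p : Model, p.1 ≠ 0 →
    (expr 1 (transition p)).compContinuousLinearMap (fderiv ℝ transition p) = expr 0 p

/-- A form is closed if its exterior derivative vanishes. -/
def Form.IsClosed {k : ℕ} (Ω : Form k) : Prop := ∀ i p, extDeriv (Ω.expr i) p = 0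

/-! ### The metric and its unitary coframe

The following expressions in the coordinates `p = (w, ζ)` are the same for the two charts. -/

/-- `e = 2 dw / (1 + |w|²)`. -/
def e (p : Model) : Covector := ((2 / (1 + ‖p.1‖ ^ 2) : ℝ) : ℂ) • ContinuousLinearMap.fst ℝ ℂ ℂ

/-- `a = Im (w̄ dw / (1 + |w|²))`. -/
def a (p : Model) : Model →L[ℝ] ℝ :=
  (1 / (1 + ‖p.1‖ ^ 2) : ℝ) • (imCLM ∘L (conj p.1 • ContinuousLinearMap.fst ℝ ℂ ℂ))

/-- `θ = dζ + 2 i ζ a`. -/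
def θ (p : Model) : Covector :=
  ContinuousLinearMap.snd ℝ ℂ ℂ + (2 * I * p.2) • (ofRealCLM ∘L a p)

/-- `e₁ = (κ + |ζ|²)^(1/4) e / 2`. -/
def e₁ (κ : ℝ) (p : Model) : Covector :=
  ((1 / 2 * (κ + ‖p.2‖ ^ 2) ^ (1 / 4 : ℝ) : ℝ) : ℂ) • e p

/-- `e₂ = (κ + |ζ|²)^(-1/4) θ / 2`. -/
def e₂ (κ : ℝ) (p : Model) : Covector :=
  ((1 / 2 * (κ + ‖p.2‖ ^ 2) ^ (-1 / 4 : ℝ) : ℝ) : ℂ) • θ p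

/-- The Eguchi-Hanson metric
`g = (|ζ|² + κ)^(1/2) |dw|² / (1 + |w|²)² + (|ζ|² + κ)^(-1/2) |dζ + 2 i ζ a|² / 4`. -/
def g (κ : ℝ) (p u v : Model) : ℝ :=
  √(‖p.2‖ ^ 2 + κ) * ((u.1 * conj v.1).re / (1 + ‖p.1‖ ^ 2) ^ 2) +
    (√(‖p.2‖ ^ 2 + κ))⁻¹ * (1 / 4) * (θ p u * conj (θ p v)).re

theorem fderiv_transition {p : Model} (hp : p.1 ≠ 0) (v : Model) :
    fderiv ℝ transition p v = (-v.1 / p.1 ^ 2,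
      v.2 * (p.1 / conj p.1) +
        p.2 * ((v.1 * conj p.1 - p.1 * conj v.1) / conj p.1 ^ 2)) := by
  have hc : conj p.1 ≠ 0 := by simpa using hp
  have h1 : HasFDerivAt (fun q : Model => q.1) (ContinuousLinearMap.fst ℝ ℂ ℂ) p :=
    hasFDerivAt_fst
  have h2 : HasFDerivAt (fun q : Model => q.2) (ContinuousLinearMap.snd ℝ ℂ ℂ) p :=
    hasFDerivAt_snd
  have h3 : HasFDerivAt (fun q : Model => conj q.1)
      ((conjCLE : ℂ →L[ℝ] ℂ) ∘L ContinuousLinearMap.fst ℝ ℂ ℂ) p :=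
    (conjCLE : ℂ →L[ℝ] ℂ).hasFDerivAt.comp p h1
  have hi : HasFDerivAt (fun q : Model => (q.1)⁻¹) _ p :=
    ((hasFDerivAt_inv hp).restrictScalars ℝ).comp p h1
  have hj : HasFDerivAt (fun q : Model => (conj q.1)⁻¹) _ p :=
    ((hasFDerivAt_inv hc).restrictScalars ℝ).comp p h3
  have ht : transition = fun q : Model => ((q.1)⁻¹, q.2 * (q.1 * (conj q.1)⁻¹)) := by
    ext1 q; simp [transition, div_eq_mul_inv]
  have h : HasFDerivAt transition _ p := ht ▸ hi.prodMk (h2.mul (h1.mul hj))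
  rw [h.fderiv]
  ext1
  · simp; field_simp
  · simp; field_simp; ring

theorem e_transition {p : Model} (hp : p.1 ≠ 0) (v : Model) :
    e (transition p) (fderiv ℝ transition p v) = -(conj p.1 / p.1) * e p v := by
  have hc : conj p.1 ≠ 0 := by simpa using hp
  have hn : (1 + p.1 * conj p.1 : ℂ) ≠ 0 := by
    rw [mul_conj, normSq_eq_norm_sq]; exact_mod_cast (by positivity : (0 : ℝ) < _).ne'
  have hs : ((‖p.1‖ : ℝ) : ℂ) ^ 2 = p.1 * conj p.1 := by
    rw [mul_conj, normSq_eq_norm_sq]; push_cast; rfl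
  rw [fderiv_transition hp]
  simp [e, transition, hs]
  field_simp
  ring

theorem θ_transition {p : Model} (hp : p.1 ≠ 0) (v : Model) :
    θ (transition p) (fderiv ℝ transition p v) = p.1 / conj p.1 * θ p v := by
  have hc : conj p.1 ≠ 0 := by simpa using hp
  have hn : (1 + p.1 * conj p.1 : ℂ) ≠ 0 := by
    rw [mul_conj, normSq_eq_norm_sq]; exact_mod_cast (by positivity : (0 : ℝ) < _).ne'
  have hs : ((‖p.1‖ : ℝ) : ℂ) ^ 2 = p.1 * conj p.1 := by
    rw [mul_conj, normSq_eq_norm_sq]; push_cast; rfl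
  have him : ∀ x : ℂ, ((x.im : ℝ) : ℂ) = (x - conj x) / (2 * I) := fun x => by
    rw [Complex.im_eq_sub_conj]
  rw [fderiv_transition hp]
  simp only [θ, a, transition, add_apply, smul_apply,
    ContinuousLinearMap.comp_apply, ContinuousLinearMap.coe_snd', ContinuousLinearMap.coe_fst',
    ofRealCLM_apply, imCLM_apply, smul_eq_mul, norm_inv]
  push_cast
  simp only [him, map_mul, map_div₀, map_inv₀, map_neg, map_pow, conj_conj, inv_pow, hs]
  have hn' : (p.1 * conj p.1 + 1 : ℂ) ≠ 0 := by rwa [add_comm]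
  field_simp
  ring

/-- The expressions of the metric in the two charts agree on the overlap. -/
theorem g_transition (κ : ℝ) {p : Model} (hp : p.1 ≠ 0) (u v : Model) :
    g κ (transition p) (fderiv ℝ transition p u) (fderiv ℝ transition p v) = g κ p u v := by
  have hc : conj p.1 ≠ 0 := by simpa using hp
  have hg : ∀ q u v : Model, g κ q u v = √(‖q.2‖ ^ 2 + κ) * (1 / 4) * (e q u * conj (e q v)).re +
      (√(‖q.2‖ ^ 2 + κ))⁻¹ * (1 / 4) * (θ q u * conj (θ q v)).re := fun q u v => by
    have : e q u * conj (e q v) = (((2 / (1 + ‖q.1‖ ^ 2)) ^ 2 : ℝ) : ℂ) * (u.1 * conj v.1) := by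
      simp only [e, smul_apply, ContinuousLinearMap.coe_fst', smul_eq_mul, map_mul, conj_ofReal]
      push_cast
      ring
    rw [this, re_ofReal_mul, g, div_pow]; ring
  have hz : ‖(transition p).2‖ = ‖p.2‖ := by
    have : ‖p.1‖ ≠ 0 := by simpa using hp
    simp [transition, div_self this]
  have h1 : ∀ x y : ℂ, -(conj p.1 / p.1) * x * conj (-(conj p.1 / p.1) * y) = x * conj y :=
    fun x y => by simp; field_simp
  have h2 : ∀ x y : ℂ, p.1 / conj p.1 * x * conj (p.1 / conj p.1 * y) = x * conj y :=
    fun x y => by simp; field_simp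
  rw [hg, hg p, e_transition hp, e_transition hp, θ_transition hp, θ_transition hp, h1, h2, hz]

/-- Orthonormal frames of the tangent space at the point with coordinates `p`. -/
def IsOrthonormalFrame (κ : ℝ) (p : Model) (b : Fin 4 → Model) : Prop :=
  ∀ i j, g κ p (b i) (b j) = if i = j then 1 else 0

/-- The real coordinates `(Re w, Im w, Re ζ, Im ζ)` of a tangent vector. -/
def realCoords (v : Model) : Fin 4 → ℝ := ![v.1.re, v.1.im, v.2.re, v.2.im]

/-- Positively oriented frames, for the orientation as a complex surface. -/
def IsPositive (b : Fin 4 → Model) : Prop := 0 < (Matrix.of fun i => realCoords (b i)).det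

/-- `β` is the Hodge dual of the 2-form `α` on the tangent space at `p`: in every positively oriented
orthonormal frame `β(b₀, b₁) = α(b₂, b₃)`. (The other components are covered by the even
permutations of the frame.) -/
def IsHodgeDual (κ : ℝ) (p : Model) (α β : Model [⋀^Fin 2]→L[ℝ] ℂ) : Prop :=
  ∀ b, IsOrthonormalFrame κ p b → IsPositive b → β ![b 0, b 1] = α ![b 2, b 3]

/-- Anti-self-duality, `*Ω = -Ω`. -/
def Form.IsAntiSelfDual (κ : ℝ) (Ω : Form 2) : Prop :=
  ∀ i p, IsHodgeDual κ p (Ω.expr i p) (-Ω.expr i p)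

/-- The squared norm `|α|² = ∑_{i<j} |α(bᵢ, bⱼ)|²` of a 2-form on the tangent space at `p` is `r`;
equivalently, `α ∧ *ᾱ = r vol`. -/
def HasNormSq (κ : ℝ) (p : Model) (α : Model [⋀^Fin 2]→L[ℝ] ℂ) (r : ℝ) : Prop :=
  ∀ b, IsOrthonormalFrame κ p b → ∑ i, ∑ j with i < j, ‖α ![b i, b j]‖ ^ 2 = r

/-- The coordinate vectors `∂/∂(Re w), ∂/∂(Im w), ∂/∂(Re ζ), ∂/∂(Im ζ)`. -/
def coordVec : Fin 4 → Model := ![(1, 0), (I, 0), (0, 1), (0, I)]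

/-- The Riemannian volume density `√(det g)` in a bundle chart. -/
def volDensity (κ : ℝ) (p : Model) : ℝ :=
  √(Matrix.of fun i j => g κ p (coordVec i) (coordVec j)).det

/-- The Riemannian volume measure in the coordinates of a bundle chart. -/
def chartVol (κ : ℝ) : Measure Model :=
  volume.withDensity fun p => ENNReal.ofReal (volDensity κ p)

/-- The Riemannian volume measure of the manifold. -/
def vol (κ : ℝ) : Measure EH :=
  (chartVol κ).map (chart 0) + ((chartVol κ).map (chart 1)).restrict (Set.range (chart 0))ᶜ

/-- A smooth 2-form is `L²` if its pointwise squared norm has a finite integral. -/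
def Form.IsL2 (κ : ℝ) (Ω : Form 2) : Prop :=
  ∃ N : EH → ℝ, (∀ i p, HasNormSq κ p (Ω.expr i p) (N (chart i p))) ∧ Integrable N (vol κ)

/-- The integral of a 2-form over the zero section `ℂP¹ = {ζ = 0}`, with its complex orientation. The
coordinate `w` covers `ℂP¹` up to one point. -/
def Form.flux (Ω : Form 2) : ℂ := ∫ w : ℂ, Ω.expr 0 (w, 0) ![(1, 0), (I, 0)]

/-- The expression `(s F)⁻² (i/2) (e₁ ∧ ē₁ - e₂ ∧ ē₂)` at the point with coordinates `p` in the
`i`-th chart. -/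
def omegaTilde (κ : ℝ) (i : Fin 2) (p : Model) : Model [⋀^Fin 2]→L[ℝ] ℂ :=
  (((sF κ (chart i p) ^ 2)⁻¹ : ℝ) * (I / 2) : ℂ) •
    (wedge (e₁ κ p) (conjForm (e₁ κ p)) - wedge (e₂ κ p) (conjForm (e₂ κ p)))

/-! ### The coordinates `(z₁, z₂)`

They are defined up to a common sign on the complement of the zero section:
`(z₁, z₂) ↦ (w, ζ) = (z₁ / z₂, (|z₁|² + |z₂|²) z₂ / z̄₂)` is a two-to-one map from `ℂ² ∖ {0}`. -/

/-- `|z₁|² + |z₂|²`, which is `s` in the coordinates `(z₁, z₂)`. -/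
def sz (z : Model) : ℝ := ‖z.1‖ ^ 2 + ‖z.2‖ ^ 2

/-- `F = √(1 + κ / s²)` in the coordinates `(z₁, z₂)`. -/
def F (κ : ℝ) (z : Model) : ℝ := √(1 + κ / sz z ^ 2)

/-- The part of `ℂ² ∖ {0}` that is mapped to the `i`-th bundle chart. -/
def zDomain : Fin 2 → Set Model := ![{z | z.2 ≠ 0}, {z | z.1 ≠ 0}]

/-- The map from `ℂ² ∖ {0}` to the manifold, in the `i`-th bundle chart. -/
def zMap : Fin 2 → Model → Model :=
  ![fun z => (z.1 / z.2, (sz z : ℂ) * (z.2 / conj z.2)),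
    fun z => (z.2 / z.1, (sz z : ℂ) * (z.1 / conj z.1))]

/-- `η` is the expression of `Ω` in the coordinates `(z₁, z₂)`, i.e. its pullback to `ℂ² ∖ {0}`. -/
def Form.HasZExpr {k : ℕ} (Ω : Form k) (η : Model → Model [⋀^Fin k]→L[ℝ] ℂ) : Prop :=
  ∀ i, ∀ z ∈ zDomain i,
    (Ω.expr i (zMap i z)).compContinuousLinearMap (fderiv ℝ (zMap i) z) = η z

/-- The 1-form `z₁ dz̄₁ + z₂ dz̄₂`. -/
def zdzbar (z : Model) : Covector :=
  z.1 • conjForm (ContinuousLinearMap.fst ℝ ℂ ℂ) + z.2 • conjForm (ContinuousLinearMap.snd ℝ ℂ ℂ)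

/-- The 1-form `(z₁ dz̄₁ + z₂ dz̄₂) / (F s²)`. -/
def β (κ : ℝ) (z : Model) : Covector := ((1 / (F κ z * sz z ^ 2) : ℝ) : ℂ) • zdzbar z

/-- The 1-form `A = √κ (z₁ dz̄₁ + z₂ dz̄₂) / (2 s² F)`. -/
def A (κ : ℝ) (z : Model) : Covector := ((√κ / (2 * sz z ^ 2 * F κ z) : ℝ) : ℂ) • zdzbar z

/-! ### Connections on line bundles -/

/-- A `U(1)` connection on a Hermitian line bundle over the manifold. The bundle is given by unitary
trivialisations over the two charts (every line bundle over `ℂ²` being trivial) and its transition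
function `h`, the connection by its imaginary-valued potentials in these trivialisations. -/
structure U1Connection where
  /-- The connection form over the `i`-th chart. -/
  pot : Fin 2 → Model → Covector
  /-- The transition function, in the coordinates of the chart with index 0. -/
  h : Model → ℂ
  pot_smooth : ∀ i, ContDiff ℝ ∞ (pot i)
  pot_imag : ∀ i p v, (pot i p v).re = 0
  h_smooth : ContDiffOn ℝ ∞ h {p | p.1 ≠ 0}
  h_unit : ∀ p : Model, p.1 ≠ 0 → ‖h p‖ = 1
  compat : ∀ p : Model, p.1 ≠ 0 →
    pot 1 (transition p) ∘L fderiv ℝ transition p = pot 0 p + (h p)⁻¹ • fderiv ℝ h p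

/-- `Ω` is the curvature `d𝒜` of the connection. -/
def U1Connection.HasCurvature (C : U1Connection) (Ω : Form 2) : Prop :=
  ∀ i p, d₁ (C.pot i) p = Ω.expr i p

/-- In the coordinates `(z₁, z₂)` the connection is given by the 1-form `α` on `ℂ² ∖ {0}`: the
pullback of the line bundle has a unitary frame over all of `ℂ² ∖ {0}` in which the connection
form is `α`. The frame is given by its gauge transformations `u i` to the two trivialisations. -/
def U1Connection.HasZPotential (C : U1Connection) (α : Model → Covector) : Prop :=
  ∃ u : Fin 2 → Model → ℂ,
    (∀ i, ContDiffOn ℝ ∞ (u i) (zDomain i)) ∧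
    (∀ i, ∀ z ∈ zDomain i, ‖u i z‖ = 1) ∧
    (∀ z ∈ zDomain 0 ∩ zDomain 1, u 1 z = u 0 z * C.h (zMap 0 z)) ∧
    ∀ i, ∀ z ∈ zDomain i,
      C.pot i (zMap i z) ∘L fderiv ℝ (zMap i) z = α z + (u i z)⁻¹ • fderiv ℝ (u i) z

end EguchiHanson

end

noncomputable section

namespace EguchiHanson

/-! ### The exterior derivative of 1-forms -/

/-! Everything rests on one explicit primitive. Away from the zero section `ω̃ = d Re(iβ/2)`, and in
a bundle chart `Re(iβ/2) = a/(2Q) + Im(ζ̄ dζ)/(4|ζ|²Q)` with `Q = √(κ + |ζ|²)`. The singularity at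
`ζ = 0` is cured by subtracting the closed form `d arg ζ/(4√κ)`: since `|ζ|² = (Q - √κ)(Q + √κ)`,
the coefficient of `Im(ζ̄ dζ)` becomes `-1/(4√κ Q(√κ + Q))`. The result, `potential`, is smooth on
each chart, so `d₁_potential` gives smoothness and closedness of `ω̃` at once. The form is global
because `e` and `θ` change only by unit phases between the charts.

Anti-self-duality and the norm are linear algebra. The components of an orthonormal frame in the
coframe form an orthogonal matrix `M`, of determinant 1 if the frame is positive, and `ω̃` has
components `Q⁻² M J Mᵀ` for a constant matrix `J`. The volume density depends on `w` alone, so the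
`L²` integral splits into two convergent integrals over `ℂ`.

The map from `ℂ² ∖ {0}` covers the dense set `ζ ≠ 0` and has invertible derivative, so a smooth form
on the manifold is determined by its pullback. As `dβ` is imaginary, `d(c(β - β̄)) = 2c dβ = -4ic
ω̃`. On the zero section `ω̃` has integral `π/√κ`, so the normalised flux is `2c/√κ`; this matches
`A = (√κ/2) β`.

Between the charts `potential` jumps by exactly `-(2√κ)⁻¹ d arg w` (`potential_transition`). If `ℓ =
2c/√κ` is an integer, the jump of `-4ic · potential` is the logarithmic derivative of `(w/|w|)^ℓ`,
which gives a line bundle with connection. Conversely, for any connection with this curvature, the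
transition function followed around the circle `|w| = 1` forces `2c/√κ` to be an integer
(`U1Connection.exists_flux_eq`). -/

theorem twoForm_ext {σ τ : Model [⋀^Fin 2]→L[ℝ] ℂ} (h : ∀ u v, σ ![u, v] = τ ![u, v]) : σ = τ := by
  ext m
  have hm : m = ![m 0, m 1] := by
    ext i : 1
    fin_cases i <;> rfl
  rw [hm, h]

/-- The identification of covectors with alternating maps in one variable. -/
def toOneForm : Covector →L[ℝ] Model [⋀^Fin 1]→L[ℝ] ℂ :=
  LinearMap.toContinuousLinearMap
    { toFun := ContinuousAlternatingMap.ofSubsingleton ℝ Model ℂ (0 : Fin 1)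
      map_add' := fun _ _ => rfl
      map_smul' := fun _ _ => rfl }

theorem d₁_eq (α : Model → Covector) : d₁ α = extDeriv fun p => toOneForm (α p) := rfl

theorem d₁_apply {α : Model → Covector} {p : Model} (hα : DifferentiableAt ℝ α p) (u v : Model) :
    d₁ α p ![u, v] = fderiv ℝ α p u v - fderiv ℝ α p v u := by
  have h : HasFDerivAt (fun q => toOneForm (α q)) (toOneForm ∘L fderiv ℝ α p) p :=
    toOneForm.hasFDerivAt.comp p hα.hasFDerivAt
  rw [d₁_eq, extDeriv, h.fderiv, ContinuousAlternatingMap.alternatizeUncurryFin_apply,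
    Fin.sum_univ_two]
  simp only [Fin.val_zero, pow_zero, one_smul, Fin.val_one, pow_one, neg_smul, ← sub_eq_add_neg]
  rfl

theorem contDiff_d₁ {α : Model → Covector} (hα : ContDiff ℝ ∞ α) : ContDiff ℝ ∞ (d₁ α) := by
  have h : ContDiff ℝ ∞ fun p => toOneForm (α p) := toOneForm.contDiff.comp hα
  exact (ContinuousAlternatingMap.alternatizeUncurryFinCLM ℝ Model ℂ).contDiff.comp
    (h.fderiv_right (m := ∞) (by simp))

theorem extDeriv_d₁ {α : Model → Covector} (hα : ContDiff ℝ ∞ α) : extDeriv (d₁ α) = 0 := by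
  have h : ContDiff ℝ ∞ fun p => toOneForm (α p) := toOneForm.contDiff.comp hα
  exact extDeriv_extDeriv h (by
    rw [minSmoothness_of_isRCLikeNormedField]
    exact WithTop.coe_le_coe.2 (le_top : (2 : ℕ∞) ≤ ⊤))

theorem d₁_const_smul (c : ℂ) {α : Model → Covector} {p : Model} (hα : DifferentiableAt ℝ α p) :
    d₁ (fun q => c • α q) p = c • d₁ α p := by
  refine twoForm_ext fun u v => ?_
  rw [d₁_apply (hα.fun_const_smul c), ContinuousAlternatingMap.smul_apply, d₁_apply hα,
    fderiv_fun_const_smul hα]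
  simp [mul_sub]

theorem d₁_add {α β : Model → Covector} {p : Model} (hα : DifferentiableAt ℝ α p)
    (hβ : DifferentiableAt ℝ β p) : d₁ (fun q => α q + β q) p = d₁ α p + d₁ β p := by
  refine twoForm_ext fun u v => ?_
  rw [d₁_apply (hα.fun_add hβ), ContinuousAlternatingMap.add_apply, d₁_apply hα, d₁_apply hβ,
    fderiv_fun_add hα hβ]
  simp only [add_apply]
  ring

theorem d₁_sub {α β : Model → Covector} {p : Model} (hα : DifferentiableAt ℝ α p)
    (hβ : DifferentiableAt ℝ β p) : d₁ (fun q => α q - β q) p = d₁ α p - d₁ β p := by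
  refine twoForm_ext fun u v => ?_
  rw [d₁_apply (hα.fun_sub hβ), ContinuousAlternatingMap.sub_apply, d₁_apply hα, d₁_apply hβ,
    fderiv_fun_sub hα hβ]
  simp only [sub_apply]
  ring

/-- The Leibniz rule for a 1-form with (real-)linear coefficients. -/
theorem d₁_smul_linear_apply {f : Model → ℂ} {f' : Covector} {p : Model} (hf : HasFDerivAt f f' p)
    (B : Model →L[ℝ] Covector) (u v : Model) :
    d₁ (fun q => f q • B q) p ![u, v] =
      f' u * B p v - f' v * B p u + f p * (B u v - B v u) := by
  have h : HasFDerivAt (fun q => f q • B q) _ p := hf.smul B.hasFDerivAt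
  rw [d₁_apply h.differentiableAt, h.fderiv]
  simp
  ring

/-! ### A potential for `ω̃` in the bundle charts -/

/-- The 1-form `Im (w̄ dw)`. -/
def imFormBase : Model →L[ℝ] Covector :=
  LinearMap.toContinuousLinearMap
    { toFun := fun p => ofRealCLM ∘L imCLM ∘L (conj p.1 • ContinuousLinearMap.fst ℝ ℂ ℂ)
      map_add' := fun p q => by
        refine ContinuousLinearMap.ext fun v => ?_
        simp
        ring
      map_smul' := fun c p => by
        refine ContinuousLinearMap.ext fun v => ?_
        simp
        ring }

theorem imFormBase_apply (p v : Model) : imFormBase p v = ((conj p.1 * v.1).im : ℂ) := rfl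

/-- The 1-form `Im (ζ̄ dζ)`. -/
def imFormFibre : Model →L[ℝ] Covector :=
  LinearMap.toContinuousLinearMap
    { toFun := fun p => ofRealCLM ∘L imCLM ∘L (conj p.2 • ContinuousLinearMap.snd ℝ ℂ ℂ)
      map_add' := fun p q => by
        refine ContinuousLinearMap.ext fun v => ?_
        simp
        ring
      map_smul' := fun c p => by
        refine ContinuousLinearMap.ext fun v => ?_
        simp
        ring }

theorem imFormFibre_apply (p v : Model) : imFormFibre p v = ((conj p.2 * v.2).im : ℂ) := rfl

/-- The function `√(κ + |ζ|²)`, the expression of `s F` in a bundle chart. -/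
def Q (κ : ℝ) (p : Model) : ℝ := √(κ + ‖p.2‖ ^ 2)

theorem Q_pos {κ : ℝ} (hκ : 0 < κ) (p : Model) : 0 < Q κ p := Real.sqrt_pos.2 (by positivity)

theorem Q_sq {κ : ℝ} (hκ : 0 < κ) (p : Model) : Q κ p ^ 2 = κ + ‖p.2‖ ^ 2 :=
  Real.sq_sqrt (by positivity)

theorem sF_chart (κ : ℝ) (i : Fin 2) (p : Model) : sF κ (chart i p) = Q κ p := rfl

theorem contDiff_Q {κ : ℝ} (hκ : 0 < κ) : ContDiff ℝ ∞ (Q κ) := by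
  have h : ContDiff ℝ ∞ fun p : Model => κ + ‖p.2‖ ^ 2 :=
    contDiff_const.add (contDiff_snd.norm_sq ℝ)
  exact h.sqrt fun p => by positivity

theorem hasFDerivAt_norm_sq_fst (p : Model) :
    HasFDerivAt (fun q : Model => ‖q.1‖ ^ 2)
      ((2 : ℝ) • (reCLM ∘L (conj p.1 • ContinuousLinearMap.fst ℝ ℂ ℂ))) p := by
  refine (hasFDerivAt_fst (𝕜 := ℝ) (p := p)).norm_sq.congr_fderiv
    (ContinuousLinearMap.ext fun v => ?_)
  simp [Complex.inner]
  ring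

theorem hasFDerivAt_norm_sq_snd (p : Model) :
    HasFDerivAt (fun q : Model => ‖q.2‖ ^ 2)
      ((2 : ℝ) • (reCLM ∘L (conj p.2 • ContinuousLinearMap.snd ℝ ℂ ℂ))) p := by
  refine (hasFDerivAt_snd (𝕜 := ℝ) (p := p)).norm_sq.congr_fderiv
    (ContinuousLinearMap.ext fun v => ?_)
  simp [Complex.inner]
  ring

theorem hasFDerivAt_Q {κ : ℝ} (hκ : 0 < κ) (p : Model) :
    HasFDerivAt (Q κ) ((Q κ p)⁻¹ • (reCLM ∘L (conj p.2 • ContinuousLinearMap.snd ℝ ℂ ℂ))) p := by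
  refine (((hasFDerivAt_norm_sq_snd p).const_add κ).sqrt (by positivity)).congr_fderiv ?_
  rw [smul_smul, Q]
  congr 1
  field_simp

/-- The coefficient of `Im (w̄ dw)` in the potential. -/
def baseCoeff (κ : ℝ) (p : Model) : ℝ := (2 * (Q κ p * (1 + ‖p.1‖ ^ 2)))⁻¹

/-- The coefficient of `Im (ζ̄ dζ)` in the potential. -/
def fibreCoeff (κ : ℝ) (p : Model) : ℝ := -(4 * √κ * (Q κ p * (√κ + Q κ p)))⁻¹

/-- The 1-form `a / (2 √(κ + |ζ|²)) - Im (ζ̄ dζ) / (4 √κ √(κ + |ζ|²) (√κ + √(κ + |ζ|²)))`. Its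
exterior derivative is `ω̃`. -/
def potential (κ : ℝ) (p : Model) : Covector :=
  (baseCoeff κ p : ℂ) • imFormBase p + (fibreCoeff κ p : ℂ) • imFormFibre p

theorem contDiff_baseCoeff {κ : ℝ} (hκ : 0 < κ) : ContDiff ℝ ∞ (baseCoeff κ) := by
  have h : ContDiff ℝ ∞ fun p : Model => 1 + ‖p.1‖ ^ 2 :=
    contDiff_const.add (contDiff_fst.norm_sq ℝ)
  refine (contDiff_const.mul ((contDiff_Q hκ).mul h)).inv fun p => ?_
  have := Q_pos hκ p
  positivity

/-- This is the point of removing `d arg ζ/(4√κ)`: the denominator contains `√κ + Q` instead of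
`|ζ|²` and so does not vanish on the zero section. -/
theorem contDiff_fibreCoeff {κ : ℝ} (hκ : 0 < κ) : ContDiff ℝ ∞ (fibreCoeff κ) := by
  refine ((contDiff_const.mul ((contDiff_Q hκ).mul
    (contDiff_const.add (contDiff_Q hκ)))).inv fun p => ?_).neg
  have := Q_pos hκ p
  positivity

theorem contDiff_potential {κ : ℝ} (hκ : 0 < κ) : ContDiff ℝ ∞ (potential κ) :=
  ((ofRealCLM.contDiff.comp (contDiff_baseCoeff hκ)).smul imFormBase.contDiff).add
    ((ofRealCLM.contDiff.comp (contDiff_fibreCoeff hκ)).smul imFormFibre.contDiff)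

theorem exists_hasFDerivAt_baseCoeff {κ : ℝ} (hκ : 0 < κ) (p : Model) :
    ∃ f' : Covector, HasFDerivAt (fun q => (baseCoeff κ q : ℂ)) f' p ∧
      ∀ v, f' v = ((-((conj p.2 * v.2).re / Q κ p * (1 + ‖p.1‖ ^ 2) +
        Q κ p * (2 * (conj p.1 * v.1).re)) / (2 * (Q κ p * (1 + ‖p.1‖ ^ 2)) ^ 2) : ℝ) : ℂ) := by
  have hQ := Q_pos hκ p
  have h := (((hasFDerivAt_Q hκ p).mul ((hasFDerivAt_norm_sq_fst p).const_add 1)).const_mul 2)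
  have h2 := (hasDerivAt_inv (x := 2 * (Q κ p * (1 + ‖p.1‖ ^ 2)))
    (by positivity)).comp_hasFDerivAt p h
  refine ⟨_, ofRealCLM.hasFDerivAt.comp p h2, fun v => ?_⟩
  simp only [ContinuousLinearMap.comp_apply, ofRealCLM_apply, smul_apply, add_apply, smul_eq_mul,
    reCLM_apply, ContinuousLinearMap.coe_fst', ContinuousLinearMap.coe_snd']
  congr 1
  field_simp
  ring

theorem exists_hasFDerivAt_fibreCoeff {κ : ℝ} (hκ : 0 < κ) (p : Model) :
    ∃ f' : Covector, HasFDerivAt (fun q => (fibreCoeff κ q : ℂ)) f' p ∧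
      ∀ v, f' v = (((√κ + 2 * Q κ p) * ((conj p.2 * v.2).re / Q κ p) /
        (4 * √κ * (Q κ p * (√κ + Q κ p)) ^ 2) : ℝ) : ℂ) := by
  have hQ := Q_pos hκ p
  have h := (((hasFDerivAt_Q hκ p).mul ((hasFDerivAt_Q hκ p).const_add (√κ))).const_mul (4 * √κ))
  have h2 := ((hasDerivAt_inv (x := 4 * √κ * (Q κ p * (√κ + Q κ p)))
    (by positivity)).comp_hasFDerivAt p h).neg
  refine ⟨_, ofRealCLM.hasFDerivAt.comp p h2, fun v => ?_⟩
  simp only [ContinuousLinearMap.comp_apply, ofRealCLM_apply, smul_apply, add_apply, smul_eq_mul,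
    reCLM_apply, ContinuousLinearMap.coe_snd', neg_apply]
  congr 1
  field_simp
  ring

theorem θ_apply (p v : Model) :
    θ p v = v.2 + 2 * I * p.2 * (((conj p.1 * v.1).im / (1 + ‖p.1‖ ^ 2) : ℝ) : ℂ) := by
  simp only [θ, a, add_apply, smul_apply, ContinuousLinearMap.comp_apply, imCLM_apply, smul_eq_mul,
    ContinuousLinearMap.coe_fst', ContinuousLinearMap.coe_snd', ofRealCLM_apply, div_eq_inv_mul,
    mul_one]

theorem e_apply (p v : Model) : e p v = ((2 / (1 + ‖p.1‖ ^ 2) : ℝ) : ℂ) * v.1 := by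
  simp [e]

/-- Both wedge products have the form `α ∧ ᾱ`, hence are imaginary, so `ω̃` is a real form. The
fractional powers occur only squared, as `Q` and `Q⁻¹`. -/
theorem omegaTilde_apply {κ : ℝ} (hκ : 0 < κ) (i : Fin 2) (p u v : Model) :
    omegaTilde κ i p ![u, v] = (((Q κ p)⁻¹ ^ 3 * (θ p u * conj (θ p v)).im -
      (Q κ p)⁻¹ * (e p u * conj (e p v)).im) / 4 : ℝ) := by
  have hQ := Q_pos hκ p
  have h1 : (κ + ‖p.2‖ ^ 2) ^ (1 / 4 : ℝ) * (κ + ‖p.2‖ ^ 2) ^ (1 / 4 : ℝ) = Q κ p := by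
    rw [← Real.rpow_add (by positivity), Q, Real.sqrt_eq_rpow]; norm_num
  have h2 : (κ + ‖p.2‖ ^ 2) ^ (-1 / 4 : ℝ) * (κ + ‖p.2‖ ^ 2) ^ (-1 / 4 : ℝ) = (Q κ p)⁻¹ := by
    rw [← Real.rpow_add (by positivity), Q, Real.sqrt_eq_rpow, ← Real.rpow_neg (by positivity)]
    norm_num
  have h3 : ∀ (r x : ℝ) (α : Covector), r * r = x →
      wedge (((1 / 2 * r : ℝ) : ℂ) • α) (conjForm (((1 / 2 * r : ℝ) : ℂ) • α)) ![u, v] =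
        I / 2 * x * (α u * conj (α v)).im := fun r x α hx => by
    have h : ∀ a b : ℂ, a * conj b - b * conj a = 2 * I * ((a * conj b).im : ℝ) := fun a b => by
      apply Complex.ext <;> simp <;> ring
    rw [wedge_apply]
    simp only [conjForm, ContinuousLinearMap.comp_apply, smul_apply, smul_eq_mul,
      ContinuousLinearEquiv.coe_coe, conjCLE_apply, map_mul, conj_ofReal]
    rw [← hx]
    push_cast
    linear_combination (1 / 4 * (r : ℂ) ^ 2) * h (α u) (α v)
  rw [omegaTilde, ContinuousAlternatingMap.smul_apply, ContinuousAlternatingMap.sub_apply, e₁, e₂,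
    h3 _ _ _ h1, h3 _ _ _ h2, sF_chart, smul_eq_mul]
  have hQ' : (Q κ p : ℂ) ≠ 0 := by exact_mod_cast hQ.ne'
  push_cast
  field_simp
  ring_nf
  simp only [I_sq]
  ring

theorem d₁_potential {κ : ℝ} (hκ : 0 < κ) (i : Fin 2) (p : Model) :
    d₁ (potential κ) p = omegaTilde κ i p := by
  have hQ := Q_pos hκ p
  have hk : 0 < √κ := Real.sqrt_pos.2 hκ
  have hs : ‖p.2‖ ^ 2 = Q κ p ^ 2 - √κ ^ 2 := by rw [Q_sq hκ, Real.sq_sqrt hκ.le]; ring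
  obtain ⟨f, hf, hf'⟩ := exists_hasFDerivAt_baseCoeff hκ p
  obtain ⟨g, hg, hg'⟩ := exists_hasFDerivAt_fibreCoeff hκ p
  refine twoForm_ext fun u v => ?_
  -- Imaginary part of `conj (z̄a) · (z̄b) = |z|² āb`. It turns `d|z|² ∧ Im(z̄ dz)` into a multiple
  -- of the area form of the `z`-plane.
  have key : ∀ z a b : ℂ, (conj z * a).re * (conj z * b).im - (conj z * b).re * (conj z * a).im =
      ‖z‖ ^ 2 * (conj a * b).im := fun z a b => by
    rw [← normSq_eq_norm_sq, normSq_apply]; simp; ring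
  have k1 := key p.1 u.1 v.1
  have k2 := key p.2 u.2 v.2
  rw [hs] at k2
  have hN : 0 < 1 + ‖p.1‖ ^ 2 := by positivity
  have hW : ‖p.1‖ ^ 2 = (1 + ‖p.1‖ ^ 2) - 1 := by ring
  have e1 : (e p u * conj (e p v)).im = -(2 / (1 + ‖p.1‖ ^ 2)) ^ 2 * (conj u.1 * v.1).im := by
    rw [e_apply, e_apply]; generalize 2 / (1 + ‖p.1‖ ^ 2) = x; simp; ring
  have e2 : (θ p u * conj (θ p v)).im = -(conj u.2 * v.2).im +
      2 * ((conj p.1 * u.1).im / (1 + ‖p.1‖ ^ 2)) * (conj p.2 * v.2).re -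
      2 * ((conj p.1 * v.1).im / (1 + ‖p.1‖ ^ 2)) * (conj p.2 * u.2).re := by
    rw [θ_apply, θ_apply]
    generalize (conj p.1 * u.1).im / (1 + ‖p.1‖ ^ 2) = x
    generalize (conj p.1 * v.1).im / (1 + ‖p.1‖ ^ 2) = y
    simp; ring
  have hi : ∀ a b : ℂ, (conj b * a).im = -(conj a * b).im := fun a b => by simp; ring
  unfold potential
  rw [d₁_add (hf.differentiableAt.fun_smul imFormBase.differentiableAt)
    (hg.differentiableAt.fun_smul imFormFibre.differentiableAt), ContinuousAlternatingMap.add_apply,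
    d₁_smul_linear_apply hf, d₁_smul_linear_apply hg, hf', hf', hg', hg', omegaTilde_apply hκ,
    e1, e2]
  simp only [imFormBase_apply, imFormFibre_apply, hi u.1 v.1, hi u.2 v.2, baseCoeff, fibreCoeff]
  norm_cast
  rw [hW] at k1
  generalize 1 + ‖p.1‖ ^ 2 = N at *
  generalize Q κ p = q at *
  generalize √κ = k at *
  generalize (conj u.1 * v.1).im = I1 at *
  generalize (conj u.2 * v.2).im = I2 at *
  generalize (conj p.1 * u.1).im = x1 at *
  generalize (conj p.1 * v.1).im = y1 at *
  generalize (conj p.2 * u.2).im = x2 at *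
  generalize (conj p.2 * v.2).im = y2 at *
  generalize (conj p.1 * u.1).re = x3 at *
  generalize (conj p.1 * v.1).re = y3 at *
  generalize (conj p.2 * u.2).re = x4 at *
  generalize (conj p.2 * v.2).re = y4 at *
  have hkq : 0 < k + q := by positivity
  -- Group the antisymmetrised products so that the left-hand sides of `k1` and `k2` appear. The
  -- mixed base-fibre term already agrees with the one coming from `θ ∧ θ̄`.
  trans -(1 / (q * N ^ 2)) * (x3 * y1 - y3 * x1) +
    (k + 2 * q) / (4 * k * (q * (k + q)) ^ 2 * q) * (x4 * y2 - y4 * x2) -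
    (x4 * y1 - y4 * x1) / (2 * q ^ 3 * N) + (2 * (q * N))⁻¹ * (2 * I1) -
    (4 * k * (q * (k + q)))⁻¹ * (2 * I2)
  · field_simp
    ring
  · rw [k1, k2]
    field_simp
    ring

/-! ### The form `ω̃` -/

theorem twoForm_comp_apply (σ : Model [⋀^Fin 2]→L[ℝ] ℂ) (T : Model →L[ℝ] Model) (u v : Model) :
    σ.compContinuousLinearMap T ![u, v] = σ ![T u, T v] := by
  rw [ContinuousAlternatingMap.compContinuousLinearMap_apply]
  congr 1
  ext i : 1
  fin_cases i <;> rfl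

theorem norm_snd_transition {p : Model} (hp : p.1 ≠ 0) : ‖(transition p).2‖ = ‖p.2‖ := by
  have : ‖p.1‖ ≠ 0 := by simpa using hp
  simp [transition, div_self this]

theorem Q_transition (κ : ℝ) {p : Model} (hp : p.1 ≠ 0) : Q κ (transition p) = Q κ p := by
  rw [Q, Q, norm_snd_transition hp]

/-- The 2-form `ω̃`. -/
def omegaForm {κ : ℝ} (hκ : 0 < κ) : Form 2 where
  expr := omegaTilde κ
  smooth i := by
    rw [← funext (d₁_potential hκ i)]
    exact contDiff_d₁ (contDiff_potential hκ)
  compat p hp := by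
    have hc : conj p.1 ≠ 0 := by simpa using hp
    refine twoForm_ext fun u v => ?_
    -- The factors by which `e` and `θ` change are unit phases, and they cancel in `e ⊗ ē` and `θ ⊗
    -- θ̄`.
    have h1 : ∀ x y : ℂ, -(conj p.1 / p.1) * x * conj (-(conj p.1 / p.1) * y) = x * conj y :=
      fun x y => by simp; field_simp
    have h2 : ∀ x y : ℂ, p.1 / conj p.1 * x * conj (p.1 / conj p.1 * y) = x * conj y :=
      fun x y => by simp; field_simp
    rw [twoForm_comp_apply, omegaTilde_apply hκ, omegaTilde_apply hκ, e_transition hp,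
      e_transition hp, θ_transition hp, θ_transition hp, h1, h2, Q_transition κ hp]

theorem omegaForm_isClosed {κ : ℝ} (hκ : 0 < κ) : (omegaForm hκ).IsClosed := fun i p => by
  change extDeriv (omegaTilde κ i) p = 0
  rw [← funext (d₁_potential hκ i), extDeriv_d₁ (contDiff_potential hκ)]
  rfl

/-! ### Frames -/

/-- The components of the vectors `b i` with respect to the coframe
`Re e₁, Im e₁, Re e₂, Im e₂`. -/
def frameMatrix (κ : ℝ) (p : Model) (b : Fin 4 → Model) : Matrix (Fin 4) (Fin 4) ℝ :=
  Matrix.of fun i => ![√(Q κ p) / 2 * (e p (b i)).re, √(Q κ p) / 2 * (e p (b i)).im,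
    (√(Q κ p))⁻¹ / 2 * (θ p (b i)).re, (√(Q κ p))⁻¹ / 2 * (θ p (b i)).im]

/-- The metric is `|e₁|² + |e₂|²`, so Gram matrices factor through components in the coframe; in
particular, orthonormal frames have orthogonal component matrices. -/
theorem frameMatrix_mul_transpose {κ : ℝ} (hκ : 0 < κ) (p : Model) (b : Fin 4 → Model) :
    frameMatrix κ p b * (frameMatrix κ p b).transpose = Matrix.of fun i j => g κ p (b i) (b j) := by
  ext i j
  have hQ := Q_pos hκ p
  have hr : √(Q κ p) * √(Q κ p) = Q κ p := Real.mul_self_sqrt hQ.le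
  have hr0 : 0 < √(Q κ p) := Real.sqrt_pos.2 hQ
  have hr' : (√(Q κ p))⁻¹ * (√(Q κ p))⁻¹ = (Q κ p)⁻¹ := by rw [← mul_inv, hr]
  have he : ∀ u v : Model, (u.1 * conj v.1).re / (1 + ‖p.1‖ ^ 2) ^ 2 =
      1 / 4 * (e p u * conj (e p v)).re := fun u v => by
    rw [e_apply, e_apply]
    have hN : 0 < 1 + ‖p.1‖ ^ 2 := by positivity
    generalize 1 + ‖p.1‖ ^ 2 = N at *
    have : ((2 / N : ℝ) : ℂ) * u.1 * conj (((2 / N : ℝ) : ℂ) * v.1) =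
        (((2 / N) ^ 2 : ℝ) : ℂ) * (u.1 * conj v.1) := by
      simp only [map_mul, conj_ofReal]; push_cast; ring
    rw [this, re_ofReal_mul]
    ring
  rw [Matrix.mul_apply, Fin.sum_univ_four, Matrix.of_apply, g, he, add_comm (‖p.2‖ ^ 2) κ]
  change _ = Q κ p * _ + (Q κ p)⁻¹ * _ * _
  rw [← hr']
  simp [frameMatrix]
  linear_combination
    (1 / 4 * ((e p (b i)).re * (e p (b j)).re + (e p (b i)).im * (e p (b j)).im)) * hr

/-- The components of the coordinate vectors with respect to the coframe. -/
def coframeMatrix (κ : ℝ) (p : Model) : Matrix (Fin 4) (Fin 4) ℝ :=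
  !![√(Q κ p) / (1 + ‖p.1‖ ^ 2), 0, (√(Q κ p))⁻¹ * p.2.im * p.1.im / (1 + ‖p.1‖ ^ 2),
      -((√(Q κ p))⁻¹ * p.2.re * p.1.im / (1 + ‖p.1‖ ^ 2));
    0, √(Q κ p) / (1 + ‖p.1‖ ^ 2), -((√(Q κ p))⁻¹ * p.2.im * p.1.re / (1 + ‖p.1‖ ^ 2)),
      (√(Q κ p))⁻¹ * p.2.re * p.1.re / (1 + ‖p.1‖ ^ 2);
    0, 0, (√(Q κ p))⁻¹ / 2, 0;
    0, 0, 0, (√(Q κ p))⁻¹ / 2]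

/-- The two factors `√Q` from `e₁` cancel the two factors `√Q⁻¹` from `e₂`. Positivity says that the
coframe is compatible with the complex orientation. -/
theorem det_coframeMatrix {κ : ℝ} (hκ : 0 < κ) (p : Model) :
    (coframeMatrix κ p).det = (4 * (1 + ‖p.1‖ ^ 2) ^ 2)⁻¹ := by
  have hr0 : 0 < √(Q κ p) := Real.sqrt_pos.2 (Q_pos hκ p)
  have hu : (coframeMatrix κ p).BlockTriangular id := by
    intro i j hij
    fin_cases i <;> fin_cases j <;> first | rfl | exact absurd hij (by decide)
  rw [Matrix.det_of_isUpperTriangular hu, Fin.prod_univ_four]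
  simp [coframeMatrix]
  field_simp
  norm_num

theorem frameMatrix_eq (κ : ℝ) (p : Model) (b : Fin 4 → Model) :
    frameMatrix κ p b = (Matrix.of fun i => realCoords (b i)) * coframeMatrix κ p := by
  ext i j
  rw [Matrix.mul_apply, Fin.sum_univ_four]
  simp only [frameMatrix, e_apply, θ_apply, Matrix.of_apply]
  have hN : 0 < 1 + ‖p.1‖ ^ 2 := by positivity
  have h2 : ∀ x : ℝ, (2 * I * p.2 * (x : ℂ)).re = - 2 * p.2.im * x := fun x => by simp
  have h3 : ∀ x : ℝ, (2 * I * p.2 * (x : ℂ)).im = 2 * p.2.re * x := fun x => by simp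
  simp only [re_ofReal_mul, im_ofReal_mul, add_re, add_im, h2, h3]
  fin_cases j <;> simp [coframeMatrix, realCoords] <;> ring

theorem volDensity_eq {κ : ℝ} (hκ : 0 < κ) (p : Model) :
    volDensity κ p = (4 * (1 + ‖p.1‖ ^ 2) ^ 2)⁻¹ := by
  have h1 : (Matrix.of fun i => realCoords (coordVec i)) = 1 := by
    ext i j
    fin_cases i <;> fin_cases j <;> simp [realCoords, coordVec]
  rw [volDensity, ← frameMatrix_mul_transpose hκ, frameMatrix_eq, h1, one_mul, Matrix.det_mul,
    Matrix.det_transpose, det_coframeMatrix hκ]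
  exact Real.sqrt_mul_self (by positivity)

/-- The components of `(i/2) (e₁ ∧ ē₁ - e₂ ∧ ē₂)` with respect to the coframe. -/
def asdMatrix : Matrix (Fin 4) (Fin 4) ℝ :=
  !![0, 1, 0, 0; -1, 0, 0, 0; 0, 0, 0, -1; 0, 0, 1, 0]

theorem omegaTilde_frame {κ : ℝ} (hκ : 0 < κ) (k : Fin 2) (p : Model) (b : Fin 4 → Model)
    (i j : Fin 4) : omegaTilde κ k p ![b i, b j] = (((Q κ p ^ 2)⁻¹ *
      (frameMatrix κ p b * asdMatrix * (frameMatrix κ p b).transpose) i j : ℝ) : ℂ) := by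
  have hQ := Q_pos hκ p
  have hr : √(Q κ p) ^ 2 = Q κ p := Real.sq_sqrt hQ.le
  have hr0 : 0 < √(Q κ p) := Real.sqrt_pos.2 hQ
  rw [omegaTilde_apply hκ, Matrix.mul_apply, Fin.sum_univ_four]
  simp only [Matrix.mul_apply, Fin.sum_univ_four]
  congr 1
  rw [← hr]
  simp [frameMatrix, asdMatrix]
  field_simp
  ring

/-- Used for the norm: an orthogonal matrix has rows of length 1. -/
theorem asdMatrix_conj_orthogonal {M : Matrix (Fin 4) (Fin 4) ℝ} (hM : M * M.transpose = 1) :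
    (M * asdMatrix * M.transpose) * (M * asdMatrix * M.transpose).transpose = 1 := by
  have hM' : M.transpose * M = 1 := mul_eq_one_comm.1 hM
  have hJ : asdMatrix * asdMatrix.transpose = 1 := by
    ext i j
    fin_cases i <;> fin_cases j <;> simp [asdMatrix, Matrix.mul_apply, Fin.sum_univ_four]
  rw [Matrix.transpose_mul, Matrix.transpose_mul, Matrix.transpose_transpose]
  calc _ = M * asdMatrix * (M.transpose * M) * asdMatrix.transpose * M.transpose := by
        simp only [Matrix.mul_assoc]
    _ = 1 := by rw [hM', Matrix.mul_one, Matrix.mul_assoc M, hJ, Matrix.mul_one, hM]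

theorem asdMatrix_conj_antisymm (M : Matrix (Fin 4) (Fin 4) ℝ) (i j : Fin 4) :
    (M * asdMatrix * M.transpose) j i = -(M * asdMatrix * M.transpose) i j := by
  simp only [Matrix.mul_apply, Fin.sum_univ_four, Matrix.transpose_apply]
  simp [asdMatrix]
  ring

/-- Complementary minors of a rotation of `ℝ⁴` agree, so `asdMatrix` stays anti-self-dual. -/
theorem asdMatrix_conj_antiSelfDual {M : Matrix (Fin 4) (Fin 4) ℝ} (hM : M * M.transpose = 1)
    (hdet : M.det = 1) :
    (M * asdMatrix * M.transpose) 2 3 = -(M * asdMatrix * M.transpose) 0 1 := by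
  have ho : ∀ i j, M i 0 * M j 0 + M i 1 * M j 1 + M i 2 * M j 2 + M i 3 * M j 3 =
      if i = j then 1 else 0 := fun i j => by
    have h := congrFun (congrFun hM i) j
    rwa [Matrix.mul_apply, Fin.sum_univ_four, Matrix.one_apply] at h
  have o02 := ho 0 2
  have o03 := ho 0 3
  have o12 := ho 1 2
  have o13 := ho 1 3
  have o22 := ho 2 2
  have o23 := ho 2 3
  have o32 := ho 3 2
  have o33 := ho 3 3
  simp only [Fin.reduceEq, if_false, if_true] at o02 o03 o12 o13 o22 o23 o32 o33
  -- The last two columns of the right factor are rows 2 and 3 of `M`, which `M` sends to standard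
  -- basis vectors by orthogonality. Since `det M = 1`, taking determinants equates the minor of
  -- rows and columns 0, 1 with that of rows and columns 2, 3.
  have h1 : M * !![1, 0, M 2 0, M 3 0; 0, 1, M 2 1, M 3 1; 0, 0, M 2 2, M 3 2; 0, 0, M 2 3, M 3 3] =
      !![M 0 0, M 0 1, 0, 0; M 1 0, M 1 1, 0, 0; M 2 0, M 2 1, 1, 0; M 3 0, M 3 1, 0, 1] := by
    ext i j
    rw [Matrix.mul_apply, Fin.sum_univ_four]
    fin_cases i <;> fin_cases j <;> simp [o02, o03, o12, o13, o22, o23, o32, o33]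
  -- The same device with the other two basis vectors: rows 0, 1 and columns 2, 3 against rows 2, 3
  -- and columns 0, 1.
  have h2 : M * !![0, 0, M 2 0, M 3 0; 0, 0, M 2 1, M 3 1; 1, 0, M 2 2, M 3 2; 0, 1, M 2 3, M 3 3] =
      !![M 0 2, M 0 3, 0, 0; M 1 2, M 1 3, 0, 0; M 2 2, M 2 3, 1, 0; M 3 2, M 3 3, 0, 1] := by
    ext i j
    rw [Matrix.mul_apply, Fin.sum_univ_four]
    fin_cases i <;> fin_cases j <;> simp [o02, o03, o12, o13, o22, o23, o32, o33]
  have d1 := congrArg Matrix.det h1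
  have d2 := congrArg Matrix.det h2
  rw [Matrix.det_mul, hdet, one_mul] at d1 d2
  simp [Matrix.det_succ_row_zero, Fin.sum_univ_succ, Fin.succAbove] at d1 d2
  simp only [Matrix.mul_apply, Fin.sum_univ_four, Matrix.transpose_apply]
  simp [asdMatrix]
  linarith

theorem omegaForm_isAntiSelfDual {κ : ℝ} (hκ : 0 < κ) : (omegaForm hκ).IsAntiSelfDual κ := by
  intro k p b hb hpos
  have hM : frameMatrix κ p b * (frameMatrix κ p b).transpose = 1 := by
    rw [frameMatrix_mul_transpose hκ]
    ext i j
    rw [Matrix.of_apply, hb i j, Matrix.one_apply]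
  have hdet : (frameMatrix κ p b).det = 1 := by
    have h0 : 0 < (frameMatrix κ p b).det := by
      rw [frameMatrix_eq, Matrix.det_mul, det_coframeMatrix hκ]
      exact mul_pos hpos (by positivity)
    have h1 := congrArg Matrix.det hM
    rw [Matrix.det_mul, Matrix.det_transpose, Matrix.det_one] at h1
    nlinarith
  change (-omegaTilde κ k p) ![b 0, b 1] = omegaTilde κ k p ![b 2, b 3]
  rw [ContinuousAlternatingMap.neg_apply, omegaTilde_frame hκ, omegaTilde_frame hκ,
    asdMatrix_conj_antiSelfDual hM hdet]
  push_cast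
  ring

/-- Up to the factor `Q⁻²` the component matrix is orthogonal and antisymmetric. Its squared entries
sum to 4, and the entries above the diagonal contribute half of that. -/
theorem hasNormSq_omegaTilde {κ : ℝ} (hκ : 0 < κ) (k : Fin 2) (p : Model) :
    HasNormSq κ p (omegaTilde κ k p) (2 * (sF κ (chart k p) ^ 4)⁻¹) := by
  intro b hb
  have hM : frameMatrix κ p b * (frameMatrix κ p b).transpose = 1 := by
    rw [frameMatrix_mul_transpose hκ]
    ext i j
    rw [Matrix.of_apply, hb i j, Matrix.one_apply]
  have hS := asdMatrix_conj_orthogonal hM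
  have hA := asdMatrix_conj_antisymm (frameMatrix κ p b)
  simp only [omegaTilde_frame hκ, sF_chart, norm_real, Real.norm_eq_abs, sq_abs, mul_pow]
  generalize frameMatrix κ p b * asdMatrix * (frameMatrix κ p b).transpose = S at *
  have h : ∀ i, S i 0 * S i 0 + S i 1 * S i 1 + S i 2 * S i 2 + S i 3 * S i 3 = 1 := fun i => by
    have h := congrFun (congrFun hS i) i
    rwa [Matrix.mul_apply, Fin.sum_univ_four, Matrix.one_apply_eq] at h
  have hs : ∑ i, ∑ j with i < j, S i j ^ 2 = 2 := by
    have h0 := h 0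
    have h1 := h 1
    have h2 := h 2
    have h3 := h 3
    have z : ∀ i, S i i = 0 := fun i => by linarith [hA i i]
    rw [hA 0 1] at h1
    rw [hA 0 2, hA 1 2] at h2
    rw [hA 0 3, hA 1 3, hA 2 3] at h3
    rw [z] at h0 h1 h2 h3
    simp only [Finset.sum_filter, Fin.sum_univ_four]
    simp
    linarith
  simp only [← Finset.mul_sum, hs]
  rw [mul_comm, inv_pow, ← pow_mul]

/-! ### Square integrability -/

theorem integrable_inv_add_norm_sq {κ : ℝ} (hκ : 0 < κ) :
    Integrable fun z : ℂ => ((κ + ‖z‖ ^ 2) ^ 2)⁻¹ := by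
  have h : Integrable (fun z : ℂ => (1 + ‖z‖ ^ 2) ^ (-(4 : ℝ) / 2)) :=
    integrable_rpow_neg_one_add_norm_sq (by rw [Complex.finrank_real_complex]; norm_num)
  have hm : 0 < min κ 1 := lt_min hκ one_pos
  -- Comparison with the case `κ = 1` through `κ + |z|² ≥ min κ 1 · (1 + |z|²)`.
  refine (h.const_mul ((min κ 1 ^ 2)⁻¹)).mono' ?_ (Filter.Eventually.of_forall fun z => ?_)
  · refine (Continuous.inv₀ (by fun_prop) fun z => ?_).aestronglyMeasurable
    positivity
  · have he : (1 + ‖z‖ ^ 2) ^ (-(4 : ℝ) / 2) = ((1 + ‖z‖ ^ 2) ^ 2)⁻¹ := by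
      rw [show -(4 : ℝ) / 2 = -((2 : ℕ) : ℝ) by norm_num, Real.rpow_neg (by positivity),
        Real.rpow_natCast]
    rw [he, ← mul_inv, ← mul_pow, Real.norm_of_nonneg (by positivity)]
    have h1 := mul_le_mul_of_nonneg_right (min_le_right κ 1) (sq_nonneg ‖z‖)
    have h2 := min_le_left κ 1
    gcongr
    linarith

theorem continuous_s : Continuous s :=
  Continuous.quotient_lift (f := fun x : Fin 2 × Model => ‖x.2.2‖) (by fun_prop) _

theorem continuous_chart (i : Fin 2) : Continuous (chart i) :=
  continuous_quotient_mk'.comp (Continuous.prodMk_right i)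

theorem omegaForm_isL2 {κ : ℝ} (hκ : 0 < κ) : (omegaForm hκ).IsL2 κ := by
  refine ⟨fun x => 2 * (sF κ x ^ 4)⁻¹, hasNormSq_omegaTilde hκ, ?_⟩
  have hc : Continuous fun x => 2 * (sF κ x ^ 4)⁻¹ := by
    have : Continuous (sF κ) := by
      unfold sF
      exact (continuous_const.add (continuous_s.pow 2)).sqrt
    refine continuous_const.mul ((this.pow 4).inv₀ fun x => ?_)
    have : 0 < sF κ x := Real.sqrt_pos.2 (by positivity)
    exact pow_ne_zero 4 this.ne'
  -- The integral converges over each full chart, so the splitting of the volume measure between the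
  -- charts plays no role.
  have hi : ∀ i, Integrable (fun x => 2 * (sF κ x ^ 4)⁻¹) ((chartVol κ).map (chart i)) := by
    intro i
    rw [integrable_map_measure hc.measurable.aestronglyMeasurable
      (continuous_chart i).measurable.aemeasurable, chartVol]
    have hd : volDensity κ = fun p => (4 * (1 + ‖p.1‖ ^ 2) ^ 2)⁻¹ := funext (volDensity_eq hκ)
    rw [hd, integrable_withDensity_iff_integrable_smul' (by fun_prop) (by simp)]
    have h := (((integrable_inv_add_norm_sq one_pos).const_mul (1 / 4)).mul_prod
      ((integrable_inv_add_norm_sq hκ).const_mul 2))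
    refine h.congr (Filter.Eventually.of_forall fun p => ?_)
    have h4 : sF κ (chart i p) ^ 4 = (κ + ‖p.2‖ ^ 2) ^ 2 := by
      rw [sF_chart, ← Q_sq hκ]; ring
    simp only [Function.comp_apply, h4, smul_eq_mul]
    rw [ENNReal.toReal_ofReal (by positivity), mul_inv 4]
    norm_num
  exact (hi 0).add_measure (hi 1).restrict

/-! ### The coordinates `(z₁, z₂)` -/

/-- The coordinate in the numerator of `w` in the `i`-th chart. -/
def num : Fin 2 → Covector := ![ContinuousLinearMap.fst ℝ ℂ ℂ, ContinuousLinearMap.snd ℝ ℂ ℂ]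

/-- The coordinate in the denominator of `w` in the `i`-th chart. -/
def den : Fin 2 → Covector := ![ContinuousLinearMap.snd ℝ ℂ ℂ, ContinuousLinearMap.fst ℝ ℂ ℂ]

/-- With `num` and `den`, the two charts are treated by a single computation with `w = num / den`.
-/
theorem mem_zDomain {i : Fin 2} {z : Model} : z ∈ zDomain i ↔ den i z ≠ 0 := by
  fin_cases i <;> rfl

theorem zMap_eq (i : Fin 2) (z : Model) :
    zMap i z = (num i z / den i z, (sz z : ℂ) * (den i z / conj (den i z))) := by
  fin_cases i <;> rfl

theorem ofReal_norm_sq (x : ℂ) : (‖x‖ : ℂ) ^ 2 = x * conj x := by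
  rw [mul_conj, normSq_eq_norm_sq]; push_cast; rfl

theorem sz_eq (i : Fin 2) (z : Model) : sz z = ‖num i z‖ ^ 2 + ‖den i z‖ ^ 2 := by
  fin_cases i
  · rfl
  · exact add_comm _ _

theorem ofReal_sz (i : Fin 2) (z : Model) :
    (sz z : ℂ) = num i z * conj (num i z) + den i z * conj (den i z) := by
  rw [sz_eq i]; push_cast; rw [ofReal_norm_sq, ofReal_norm_sq]

theorem sz_pos {z : Model} (hz : z ≠ 0) : 0 < sz z := by
  by_contra! h
  have h1 : ‖z.1‖ ^ 2 = 0 := by unfold sz at h; nlinarith [sq_nonneg ‖z.1‖, sq_nonneg ‖z.2‖]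
  have h2 : ‖z.2‖ ^ 2 = 0 := by unfold sz at h; nlinarith [sq_nonneg ‖z.1‖, sq_nonneg ‖z.2‖]
  exact hz (Prod.ext (by simpa using h1) (by simpa using h2))

theorem ne_zero_of_mem_zDomain {i : Fin 2} {z : Model} (hz : z ∈ zDomain i) : z ≠ 0 := by
  rintro rfl
  exact mem_zDomain.1 hz (map_zero _)

theorem hasFDerivAt_conj_comp (α : Covector) (z : Model) :
    HasFDerivAt (fun q => conj (α q)) (conjForm α) z := (conjForm α).hasFDerivAt

theorem exists_hasFDerivAt_zMap {i : Fin 2} {z : Model} (hz : z ∈ zDomain i) :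
    ∃ D : Model →L[ℝ] Model, HasFDerivAt (zMap i) D z ∧ ∀ v, D v =
      ((num i v * den i z - num i z * den i v) / den i z ^ 2,
        (num i v * conj (num i z) + num i z * conj (num i v) +
          (den i v * conj (den i z) + den i z * conj (den i v))) * (den i z / conj (den i z)) +
        sz z * ((den i v * conj (den i z) - den i z * conj (den i v)) / conj (den i z) ^ 2)) := by
  have hy : den i z ≠ 0 := mem_zDomain.1 hz
  have hc : conj (den i z) ≠ 0 := by simpa using hy
  have h1 := (num i).hasFDerivAt (x := z)
  have h2 := (den i).hasFDerivAt (x := z)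
  have h3 := hasFDerivAt_conj_comp (num i) z
  have h4 := hasFDerivAt_conj_comp (den i) z
  have hi : HasFDerivAt (fun q => (den i q)⁻¹) _ z :=
    ((hasFDerivAt_inv hy).restrictScalars ℝ).comp z h2
  have hj : HasFDerivAt (fun q => (conj (den i q))⁻¹) _ z :=
    ((hasFDerivAt_inv hc).restrictScalars ℝ).comp z h4
  have ht : zMap i = fun q => (num i q * (den i q)⁻¹,
      (num i q * conj (num i q) + den i q * conj (den i q)) * (den i q * (conj (den i q))⁻¹)) := by
    ext1 q
    rw [zMap_eq, ofReal_sz i, div_eq_mul_inv, div_eq_mul_inv]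
  have h : HasFDerivAt (zMap i) _ z :=
    ht ▸ (h1.mul hi).prodMk (((h1.mul h3).add (h2.mul h4)).mul (h2.mul hj))
  refine ⟨_, h, fun v => ?_⟩
  rw [ofReal_sz i]
  ext1
  · simp; field_simp; ring
  · simp [conjForm]; field_simp; ring

theorem e_zMap {i : Fin 2} {z : Model} (hz : z ∈ zDomain i) (v : Model) :
    e (zMap i z) (fderiv ℝ (zMap i) z v) = conj (den i z) / den i z *
      (2 * (den i z * num i v - num i z * den i v) / sz z) := by
  have hy : den i z ≠ 0 := mem_zDomain.1 hz
  have hc : conj (den i z) ≠ 0 := by simpa using hy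
  have hs : (sz z : ℂ) ≠ 0 := by exact_mod_cast (sz_pos (ne_zero_of_mem_zDomain hz)).ne'
  obtain ⟨D, hD, hD'⟩ := exists_hasFDerivAt_zMap hz
  rw [hD.fderiv, hD', e_apply, zMap_eq]
  push_cast
  simp only [norm_div, ofReal_div, div_pow, ofReal_norm_sq]
  have hN : 1 + num i z * conj (num i z) / (den i z * conj (den i z)) =
    sz z / (den i z * conj (den i z)) := by
    rw [ofReal_sz i]; field_simp; ring
  rw [hN]
  field_simp

/-- Up to a unit phase, `θ` is twice the conjugate of `z₁ dz̄₁ + z₂ dz̄₂`. This is the link between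
the unitary coframe and `β`. -/
theorem θ_zMap {i : Fin 2} {z : Model} (hz : z ∈ zDomain i) (v : Model) :
    θ (zMap i z) (fderiv ℝ (zMap i) z v) = den i z / conj (den i z) *
      (2 * (conj (num i z) * num i v + conj (den i z) * den i v)) := by
  have hy : den i z ≠ 0 := mem_zDomain.1 hz
  have hc : conj (den i z) ≠ 0 := by simpa using hy
  have hs : (sz z : ℂ) ≠ 0 := by exact_mod_cast (sz_pos (ne_zero_of_mem_zDomain hz)).ne'
  obtain ⟨D, hD, hD'⟩ := exists_hasFDerivAt_zMap hz
  rw [hD.fderiv, hD', θ_apply, zMap_eq]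
  push_cast
  simp only [norm_div, ofReal_div, div_pow, ofReal_norm_sq]
  have hN : 1 + num i z * conj (num i z) / (den i z * conj (den i z)) =
    sz z / (den i z * conj (den i z)) := by
    rw [ofReal_sz i]; field_simp; ring
  rw [hN, Complex.im_eq_sub_conj]
  simp only [map_mul, map_div₀, map_sub, map_pow, conj_conj]
  field_simp
  rw [ofReal_sz i]
  ring

theorem norm_snd_zMap {i : Fin 2} {z : Model} (hz : z ∈ zDomain i) : ‖(zMap i z).2‖ = sz z := by
  have hy : ‖den i z‖ ≠ 0 := by simpa using mem_zDomain.1 hz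
  rw [zMap_eq]
  simp [div_self hy, abs_of_pos (sz_pos (ne_zero_of_mem_zDomain hz))]

theorem Q_zMap (κ : ℝ) {i : Fin 2} {z : Model} (hz : z ∈ zDomain i) :
    Q κ (zMap i z) = √(κ + sz z ^ 2) := by
  rw [Q, norm_snd_zMap hz]

/-! ### The exterior derivative of `β` -/

/-- The 1-form `z₁ dz̄₁ + z₂ dz̄₂`, as a linear function of the point. -/
def zdzbarL : Model →L[ℝ] Covector :=
  LinearMap.toContinuousLinearMap
    { toFun := zdzbar
      map_add' := fun p q => by
        refine ContinuousLinearMap.ext fun v => ?_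
        simp [zdzbar]
        ring
      map_smul' := fun c p => by
        refine ContinuousLinearMap.ext fun v => ?_
        simp [zdzbar]
        ring }

theorem zdzbar_apply (z v : Model) : zdzbar z v = z.1 * conj v.1 + z.2 * conj v.2 := by
  simp [zdzbar, conjForm]

theorem zdzbarL_apply (z : Model) : zdzbarL z = zdzbar z := rfl

theorem zdzbar_eq (i : Fin 2) (z v : Model) :
    zdzbar z v = num i z * conj (num i v) + den i z * conj (den i v) := by
  rw [zdzbar_apply]
  fin_cases i
  · rfl
  · exact add_comm _ _

theorem F_mul_sq (κ : ℝ) {t : ℝ} (ht : 0 < t) :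
    √(1 + κ / t ^ 2) * t ^ 2 = t * √(κ + t ^ 2) := by
  have : κ + t ^ 2 = t ^ 2 * (1 + κ / t ^ 2) := by field_simp; ring
  rw [this, Real.sqrt_mul (by positivity), Real.sqrt_sq ht.le]
  ring

theorem hasFDerivAt_sz (z : Model) : HasFDerivAt sz
    ((2 : ℝ) • (reCLM ∘L (conj z.1 • ContinuousLinearMap.fst ℝ ℂ ℂ)) +
      (2 : ℝ) • (reCLM ∘L (conj z.2 • ContinuousLinearMap.snd ℝ ℂ ℂ))) z :=
  (hasFDerivAt_norm_sq_fst z).add (hasFDerivAt_norm_sq_snd z)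

/-- For `s > 0` the coefficient is `1/(s √(κ + s²))`, a function of `s` alone, and `ds` is `zdzbar`
plus its conjugate. -/
theorem exists_hasFDerivAt_betaCoeff {κ : ℝ} (hκ : 0 < κ) {z : Model} (hz : z ≠ 0) :
    ∃ f' : Covector, HasFDerivAt (fun q => ((1 / (F κ q * sz q ^ 2) : ℝ) : ℂ)) f' z ∧
      ∀ v, f' v = ((-((√(κ + sz z ^ 2) ^ 3)⁻¹ + (√(κ + sz z ^ 2) * sz z ^ 2)⁻¹) : ℝ) : ℂ) *
        (zdzbar z v + conj (zdzbar z v)) := by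
  have hs := sz_pos hz
  have hq : 0 < √(κ + sz z ^ 2) := Real.sqrt_pos.2 (by positivity)
  have hq2 : √(κ + sz z ^ 2) ^ 2 = κ + sz z ^ 2 := Real.sq_sqrt (by positivity)
  have h1 : HasDerivAt (fun t : ℝ => √(κ + t ^ 2)) (sz z / √(κ + sz z ^ 2)) (sz z) := by
    refine ((((hasDerivAt_id (sz z)).pow 2).const_add κ).sqrt (by simp; positivity)).congr_deriv ?_
    simp
    field_simp
  have h2 := (((hasDerivAt_id (sz z)).mul h1).inv (by simp; exact ⟨hs.ne', hq.ne'⟩))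
  have h3 : HasDerivAt (fun t : ℝ => 1 / (√(1 + κ / t ^ 2) * t ^ 2))
      (-((√(κ + sz z ^ 2) ^ 3)⁻¹ + (√(κ + sz z ^ 2) * sz z ^ 2)⁻¹)) (sz z) := by
    refine (h2.congr_deriv ?_).congr_of_eventuallyEq ?_
    · simp
      field_simp
      ring
    · filter_upwards [lt_mem_nhds hs] with t ht
      rw [F_mul_sq κ ht, one_div]
      rfl
  refine ⟨_, ofRealCLM.hasFDerivAt.comp z (h3.comp_hasFDerivAt z (hasFDerivAt_sz z)), fun v => ?_⟩
  simp only [ContinuousLinearMap.comp_apply, ofRealCLM_apply, smul_apply, add_apply, smul_eq_mul,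
    reCLM_apply, ContinuousLinearMap.coe_fst', ContinuousLinearMap.coe_snd']
  rw [ofReal_mul, zdzbar_apply]
  congr 1
  push_cast
  rw [re_eq_add_conj, re_eq_add_conj]
  simp
  ring

theorem differentiableAt_β {κ : ℝ} (hκ : 0 < κ) {z : Model} (hz : z ≠ 0) :
    DifferentiableAt ℝ (β κ) z := by
  obtain ⟨f', hf, -⟩ := exists_hasFDerivAt_betaCoeff hκ hz
  exact hf.differentiableAt.fun_smul zdzbarL.differentiableAt

/-- In `ds ∧ zdzbar` only the conjugate part of `ds` survives, so both terms, and with them `dβ`,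
are purely imaginary. -/
theorem d₁_β_apply {κ : ℝ} (hκ : 0 < κ) {z : Model} (hz : z ≠ 0) (u v : Model) :
    d₁ (β κ) z ![u, v] = -2 * I * (((√(κ + sz z ^ 2) ^ 3)⁻¹ + (√(κ + sz z ^ 2) * sz z ^ 2)⁻¹) *
      (conj (zdzbar z u) * zdzbar z v).im - (√(κ + sz z ^ 2) * sz z)⁻¹ * (zdzbar u v).im : ℝ) := by
  have hs := sz_pos hz
  have hq : 0 < √(κ + sz z ^ 2) := Real.sqrt_pos.2 (by positivity)
  obtain ⟨f', hf, hf'⟩ := exists_hasFDerivAt_betaCoeff hκ hz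
  change d₁ (fun q => _ • zdzbarL q) z ![u, v] = _
  rw [d₁_smul_linear_apply hf, hf', hf', F, F_mul_sq κ hs]
  simp only [zdzbarL_apply]
  have hvu : zdzbar v u = conj (zdzbar u v) := by simp [zdzbar_apply]; ring
  push_cast
  rw [hvu, im_eq_sub_conj, im_eq_sub_conj]
  simp only [map_mul, conj_conj]
  have hq' : (√(κ + sz z ^ 2) : ℂ) ≠ 0 := by exact_mod_cast hq.ne'
  have hs' : (sz z : ℂ) ≠ 0 := by exact_mod_cast hs.ne'
  field_simp
  ring

theorem omegaForm_hasZExpr {κ : ℝ} (hκ : 0 < κ) :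
    (omegaForm hκ).HasZExpr fun z => (I / 2) • d₁ (β κ) z := by
  intro i z hz
  have hz0 := ne_zero_of_mem_zDomain hz
  have hy : den i z ≠ 0 := mem_zDomain.1 hz
  have hc : conj (den i z) ≠ 0 := by simpa using hy
  have hs := sz_pos hz0
  have hq : 0 < √(κ + sz z ^ 2) := Real.sqrt_pos.2 (by positivity)
  refine twoForm_ext fun u v => ?_
  rw [twoForm_comp_apply, ContinuousAlternatingMap.smul_apply, d₁_β_apply hκ hz0]
  change omegaTilde κ i _ _ = _
  have h1 : ∀ x y : ℂ, conj (den i z) / den i z * x * conj (conj (den i z) / den i z * y) =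
      x * conj y := fun x y => by simp; field_simp
  have h2 : ∀ x y : ℂ, den i z / conj (den i z) * x * conj (den i z / conj (den i z) * y) =
      x * conj y := fun x y => by simp; field_simp
  rw [omegaTilde_apply hκ, e_zMap hz, e_zMap hz, θ_zMap hz, θ_zMap hz, h1, h2, Q_zMap κ hz]
  have h3 : (2 * (conj (num i z) * num i u + conj (den i z) * den i u) *
      conj (2 * (conj (num i z) * num i v + conj (den i z) * den i v))).im =
      4 * (conj (zdzbar z u) * zdzbar z v).im := by
    rw [zdzbar_eq i, zdzbar_eq i, ← im_ofReal_mul]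
    congr 1
    simp only [map_mul, map_add, map_ofNat, conj_conj, ofReal_ofNat]
    ring
  -- Polarised Lagrange identity: the product of the determinants of `(z, u)` and `(z, v)`, the
  -- second conjugated, is `|z|²⟨u, v⟩ - ⟨u, z⟩⟨z, v⟩`.
  have h4 : (2 * (den i z * num i u - num i z * den i u) / (sz z : ℂ) *
      conj (2 * (den i z * num i v - num i z * den i v) / (sz z : ℂ))).im =
      4 / sz z ^ 2 * (sz z * (zdzbar u v).im - (conj (zdzbar z u) * zdzbar z v).im) := by
    have hs' : (sz z : ℂ) ≠ 0 := by exact_mod_cast hs.ne'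
    rw [← im_ofReal_mul (sz z), ← sub_im, ← im_ofReal_mul, zdzbar_eq i, zdzbar_eq i, zdzbar_eq i]
    congr 1
    simp only [map_mul, map_add, map_sub, map_div₀, map_ofNat, conj_conj, conj_ofReal, ofReal_ofNat,
      ofReal_div, ofReal_pow]
    field_simp
    rw [ofReal_sz i]
    ring
  rw [h3, h4, smul_eq_mul]
  have : ∀ x : ℝ, I / 2 * (-2 * I * (x : ℂ)) = (x : ℝ) := fun x => by
    linear_combination (-(x : ℂ)) * I_mul_I
  rw [this]
  congr 1
  field_simp
  ring

theorem d₁_conjForm {α : Model → Covector} {p : Model} (hα : DifferentiableAt ℝ α p) (u v : Model) :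
    d₁ (fun q => conjForm (α q)) p ![u, v] = conj (d₁ α p ![u, v]) := by
  have h : HasFDerivAt (fun q => conjForm (α q))
      (ContinuousLinearMap.compL ℝ Model ℂ ℂ (conjCLE : ℂ →L[ℝ] ℂ) ∘L fderiv ℝ α p) p :=
    (ContinuousLinearMap.compL ℝ Model ℂ ℂ (conjCLE : ℂ →L[ℝ] ℂ)).hasFDerivAt.comp p hα.hasFDerivAt
  rw [d₁_apply h.differentiableAt, h.fderiv, d₁_apply hα, map_sub]
  rfl

theorem differentiableAt_conjForm {α : Model → Covector} {p : Model}
    (hα : DifferentiableAt ℝ α p) : DifferentiableAt ℝ (fun q => conjForm (α q)) p :=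
  (ContinuousLinearMap.compL ℝ Model ℂ ℂ (conjCLE : ℂ →L[ℝ] ℂ)).differentiableAt.comp p hα

theorem d₁_smul_β_sub_conj {κ : ℝ} (hκ : 0 < κ) (c : ℂ) {z : Model} (hz : z ≠ 0) :
    d₁ (fun z => c • (β κ z - conjForm (β κ z))) z = (-4 * I * c) • (I / 2) • d₁ (β κ) z := by
  have h1 := differentiableAt_β hκ hz
  have h2 := differentiableAt_conjForm h1
  rw [d₁_const_smul c (h1.fun_sub h2), d₁_sub h1 h2]
  refine twoForm_ext fun u v => ?_
  simp only [ContinuousAlternatingMap.smul_apply, ContinuousAlternatingMap.sub_apply,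
    d₁_conjForm h1, d₁_β_apply hκ hz, smul_eq_mul, map_mul, conj_ofReal, conj_I, map_neg,
    map_ofNat]
  generalize ((_ : ℝ) : ℂ) = x
  linear_combination (-4 * I * c * x) * I_mul_I

/-- The multiple `-4 i c ω̃` of `ω̃`. -/
def curvatureForm {κ : ℝ} (hκ : 0 < κ) (c : ℂ) : Form 2 where
  expr i p := (-4 * I * c) • omegaTilde κ i p
  smooth i := ((omegaForm hκ).smooth i).const_smul _
  compat p hp := by
    change _ = (-4 * I * c) • (omegaForm hκ).expr 0 p
    rw [← (omegaForm hκ).compat p hp]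
    rfl

theorem curvatureForm_hasZExpr {κ : ℝ} (hκ : 0 < κ) (c : ℂ) : (curvatureForm hκ c).HasZExpr
    (d₁ fun z => c • (β κ z - conjForm (β κ z))) := fun i z hz => by
  rw [d₁_smul_β_sub_conj hκ c (ne_zero_of_mem_zDomain hz)]
  exact congrArg ((-4 * I * c) • ·) (omegaForm_hasZExpr hκ i z hz)

/-! ### Forms are determined by their expressions in the coordinates `(z₁, z₂)` -/

/-- A kernel vector is killed by the pullbacks of `e` and `θ`. These give a 2 × 2 linear system of
determinant `s ≠ 0`, so the derivative is injective, and dimensions agree. -/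
theorem fderiv_zMap_surjective {i : Fin 2} {z : Model} (hz : z ∈ zDomain i) :
    Function.Surjective (fderiv ℝ (zMap i) z) := by
  have hy : den i z ≠ 0 := mem_zDomain.1 hz
  have hc : conj (den i z) ≠ 0 := by simpa using hy
  have hs : (sz z : ℂ) ≠ 0 := by exact_mod_cast (sz_pos (ne_zero_of_mem_zDomain hz)).ne'
  refine LinearMap.injective_iff_surjective (f := (fderiv ℝ (zMap i) z : Model →ₗ[ℝ] Model)).1 ?_
  refine (injective_iff_map_eq_zero _).2 fun v hv => ?_
  have hv' : fderiv ℝ (zMap i) z v = 0 := hv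
  have h1 := e_zMap hz v
  have h2 := θ_zMap hz v
  rw [hv', map_zero] at h1 h2
  have h1' : den i z * num i v - num i z * den i v = 0 := by
    simpa [hy, hs] using h1.symm
  have h2' : conj (num i z) * num i v + conj (den i z) * den i v = 0 := by
    simpa [hy] using h2.symm
  have h3 : num i v = 0 := by
    have : (sz z : ℂ) * num i v = 0 := by
      rw [ofReal_sz i]; linear_combination num i z * h2' + conj (den i z) * h1'
    simpa [hs] using this
  have h4 : den i v = 0 := by
    have : (sz z : ℂ) * den i v = 0 := by
      rw [ofReal_sz i]; linear_combination den i z * h2' - conj (num i z) * h1'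
    simpa [hs] using this
  fin_cases i
  · exact Prod.ext h3 h4
  · exact Prod.ext h4 h3

theorem exists_zMap_eq (i : Fin 2) {p : Model} (hp : p.2 ≠ 0) : ∃ z ∈ zDomain i, zMap i z = p := by
  have hN : (1 + p.1 * conj p.1 : ℂ) ≠ 0 := by
    rw [← ofReal_norm_sq]; exact_mod_cast (by positivity : (0 : ℝ) < 1 + ‖p.1‖ ^ 2).ne'
  -- If `y` is the denominator coordinate, then `s = |y|²(1 + |w|²)` and `ζ = s y/ȳ = y²(1 + |w|²)`.
  -- The choice of square root is the common sign of `(z₁, z₂)`.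
  obtain ⟨y, hy⟩ := IsAlgClosed.exists_pow_nat_eq (p.2 / (1 + p.1 * conj p.1)) two_pos
  have hy0 : y ≠ 0 := by
    rintro rfl
    rw [zero_pow two_ne_zero] at hy
    exact div_ne_zero hp hN hy.symm
  have hc : conj y ≠ 0 := by simpa using hy0
  have hp2 : p.2 = y ^ 2 * (1 + p.1 * conj p.1) := by rw [hy]; field_simp
  obtain ⟨z, hn, hd⟩ : ∃ z, num i z = p.1 * y ∧ den i z = y := by
    fin_cases i
    · exact ⟨(p.1 * y, y), rfl, rfl⟩
    · exact ⟨(y, p.1 * y), rfl, rfl⟩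
  refine ⟨z, mem_zDomain.2 (hd ▸ hy0), ?_⟩
  rw [zMap_eq, ofReal_sz i, hn, hd]
  ext1
  · simp; field_simp
  · rw [hp2]; simp; field_simp; ring

theorem Form.eq_of_hasZExpr {Ω Ω' : Form 2} {η : Model → Model [⋀^Fin 2]→L[ℝ] ℂ}
    (h : Ω.HasZExpr η) (h' : Ω'.HasZExpr η) : Ω = Ω' := by
  have hd : Dense {p : Model | p.2 ≠ 0} := by
    have : {p : Model | p.2 ≠ 0} = Set.univ ×ˢ {(0 : ℂ)}ᶜ := by ext; simp
    rw [this]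
    exact dense_univ.prod (dense_compl_singleton 0)
  refine Form.ext (funext fun i =>
    Continuous.ext_on hd (Ω.smooth i).continuous (Ω'.smooth i).continuous fun p hp => ?_)
  obtain ⟨z, hz, rfl⟩ := exists_zMap_eq i hp
  refine twoForm_ext fun u v => ?_
  obtain ⟨u, rfl⟩ := fderiv_zMap_surjective hz u
  obtain ⟨v, rfl⟩ := fderiv_zMap_surjective hz v
  rw [← twoForm_comp_apply, ← twoForm_comp_apply, h i z hz, h' i z hz]

/-! ### The flux through the zero section -/

theorem integral_inv_one_add_norm_sq_sq :
    ∫ w : ℂ, ((1 + ‖w‖ ^ 2) ^ 2)⁻¹ = Real.pi := by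
  have h := integral_fun_norm_addHaar (volume : Measure ℂ) fun r : ℝ => ((1 + r ^ 2) ^ 2)⁻¹
  have hi : ∫ y in Set.Ioi (0 : ℝ), y * ((1 + y ^ 2) ^ 2)⁻¹ = 1 / 2 := by
    have hd : ∀ x ∈ Set.Ici (0 : ℝ), HasDerivAt (fun y : ℝ => -(2 * (1 + y ^ 2))⁻¹)
        (x * ((1 + x ^ 2) ^ 2)⁻¹) x := fun x _ => by
      have h1 : (2 * (1 + x ^ 2)) ≠ 0 := by positivity
      have h2 := ((((hasDerivAt_id x).fun_pow 2).const_add 1).const_mul 2).inv h1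
      refine h2.neg.congr_deriv ?_
      simp
      field_simp
    have ht : Filter.Tendsto (fun y : ℝ => -(2 * (1 + y ^ 2))⁻¹) Filter.atTop (nhds 0) := by
      rw [← neg_zero]
      refine (Filter.Tendsto.inv_tendsto_atTop ?_).neg
      refine Filter.Tendsto.const_mul_atTop two_pos ?_
      exact Filter.tendsto_atTop_add_const_left _ _ (Filter.tendsto_pow_atTop two_ne_zero)
    rw [integral_Ioi_of_hasDerivAt_of_nonneg' hd
      (fun x hx => mul_nonneg (le_of_lt hx) (by positivity)) ht]
    norm_num
  rw [h, Complex.finrank_real_complex]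
  simp only [Nat.add_one_sub_one, pow_one, smul_eq_mul, hi, Measure.real, Complex.volume_ball]
  simp
  ring

theorem curvatureForm_flux {κ : ℝ} (hκ : 0 < κ) (c : ℂ) :
    (curvatureForm hκ c).flux = -4 * I * c * (Real.pi / √κ : ℝ) := by
  have h : ∀ w : ℂ, (curvatureForm hκ c).expr 0 (w, 0) ![(1, 0), (I, 0)] =
      -4 * I * c * (((√κ)⁻¹ * ((1 + ‖w‖ ^ 2) ^ 2)⁻¹ : ℝ) : ℂ) := fun w => by
    change (-4 * I * c) * omegaTilde κ 0 (w, 0) ![(1, 0), (I, 0)] = _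
    rw [omegaTilde_apply hκ]
    congr 2
    have h0 : Q κ (w, 0) = √κ := by simp [Q]
    rw [h0, e_apply, e_apply, θ_apply, θ_apply]
    simp only [mul_zero, zero_mul, add_zero, mul_one, map_mul, conj_ofReal, conj_I, zero_im,
      zero_sub]
    have : ((2 / (1 + ‖w‖ ^ 2) : ℝ) : ℂ) * (((2 / (1 + ‖w‖ ^ 2) : ℝ) : ℂ) * -I) =
      ((-(2 / (1 + ‖w‖ ^ 2)) ^ 2 : ℝ) : ℂ) * I := by push_cast; ring
    rw [this, im_ofReal_mul, I_im]
    field_simp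
    norm_num
  rw [Form.flux]
  simp only [h]
  rw [integral_const_mul, integral_complex_ofReal, integral_const_mul,
    integral_inv_one_add_norm_sq_sq]
  congr 2
  ring

theorem flux_curvatureForm_div {κ : ℝ} (hκ : 0 < κ) (c : ℂ) :
    I / (2 * Real.pi) * (curvatureForm hκ c).flux = 2 * c / √κ := by
  have hk : (√κ : ℂ) ≠ 0 := by exact_mod_cast (Real.sqrt_pos.2 hκ).ne'
  have hp : (Real.pi : ℂ) ≠ 0 := by exact_mod_cast Real.pi_ne_zero
  rw [curvatureForm_flux]
  push_cast
  field_simp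
  linear_combination (-4 * c) * I_sq

theorem A_eq (κ : ℝ) (z : Model) : A κ z = (√κ / 2 : ℂ) • β κ z := by
  rw [A, β, smul_smul]
  congr 1
  push_cast
  field_simp

theorem smul_A_sub_conj (κ : ℝ) (t : ℂ) (z : Model) :
    t • (A κ z - conjForm (A κ z)) = (t * (√κ / 2)) • (β κ z - conjForm (β κ z)) := by
  refine ContinuousLinearMap.ext fun v => ?_
  have h2 : conj (√κ / 2 : ℂ) = √κ / 2 := by rw [map_div₀, conj_ofReal, map_ofNat]
  simp only [A_eq, conjForm, smul_apply, sub_apply, ContinuousLinearMap.comp_apply, smul_eq_mul,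
    ContinuousLinearEquiv.coe_coe, conjCLE_apply, map_mul, h2]
  ring

theorem flux_eq_iff {κ : ℝ} (hκ : 0 < κ) (c t : ℂ) :
    I / (2 * Real.pi) * (curvatureForm hκ c).flux = t ↔ ∀ z : Model, z ≠ 0 →
      c • (β κ z - conjForm (β κ z)) = t • (A κ z - conjForm (A κ z)) := by
  have hk : (√κ : ℂ) ≠ 0 := by exact_mod_cast (Real.sqrt_pos.2 hκ).ne'
  rw [flux_curvatureForm_div]
  constructor
  · rintro rfl z -
    rw [smul_A_sub_conj]
    congr 1
    field_simp
  · intro h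
    -- One test vector suffices: at `(1, 0)` in the direction `(i, 0)` the form `β - β̄` is nonzero.
    have h1 := congrArg (fun α : Covector => α (I, 0)) (h (1, 0) (by simp))
    rw [smul_A_sub_conj] at h1
    have h2 : (β κ (1, 0) - conjForm (β κ (1, 0))) (I, 0) ≠ 0 := by
      have hF : F κ (1, 0) ≠ 0 := (Real.sqrt_pos.2 (by positivity)).ne'
      have hs : sz ((1, 0) : Model) = 1 := by simp [sz]
      have : (β κ (1, 0) - conjForm (β κ (1, 0))) (I, 0) = -2 * I / F κ (1, 0) := by
        simp [β, conjForm, zdzbar_apply, hs]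
        ring
      rw [this]
      simp [hF]
    simp only [smul_apply, smul_eq_mul] at h1
    rw [mul_right_cancel₀ h2 h1]
    field_simp

/-! ### The potential in the overlap and in the coordinates `(z₁, z₂)` -/

theorem potential_apply (κ : ℝ) (p v : Model) : potential κ p v =
    ((baseCoeff κ p * (conj p.1 * v.1).im + fibreCoeff κ p * (conj p.2 * v.2).im : ℝ) : ℂ) := by
  simp only [potential, add_apply, smul_apply, imFormBase_apply, imFormFibre_apply, smul_eq_mul]
  push_cast
  rfl

/-- The base term jumps by `-(2Q)⁻¹ d arg w`. The fibre term contributes `-(Q - √κ)/(2√κ Q) d arg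
w`, because `arg ζ` grows by `2 arg w`. The sum has a constant coefficient, as it must since both
potentials have the same derivative. -/
theorem potential_transition {κ : ℝ} (hκ : 0 < κ) {p : Model} (hp : p.1 ≠ 0) (v : Model) :
    potential κ (transition p) (fderiv ℝ transition p v) =
      potential κ p v - (((2 * √κ)⁻¹ * (v.1 / p.1).im : ℝ) : ℂ) := by
  have hc : conj p.1 ≠ 0 := by simpa using hp
  have hQ := Q_pos hκ p
  have hk : 0 < √κ := Real.sqrt_pos.2 hκ
  have hn : 0 < ‖p.1‖ := norm_pos_iff.2 hp
  have hs : ‖p.2‖ ^ 2 = Q κ p ^ 2 - √κ ^ 2 := by rw [Q_sq hκ, Real.sq_sqrt hκ.le]; ring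
  have h1 : (conj (transition p).1 * (fderiv ℝ transition p v).1).im =
      -(v.1 / p.1).im / ‖p.1‖ ^ 2 := by
    have : conj (transition p).1 * (fderiv ℝ transition p v).1 =
        ((-(‖p.1‖ ^ 2)⁻¹ : ℝ) : ℂ) * (v.1 / p.1) := by
      rw [fderiv_transition hp]
      push_cast
      rw [ofReal_norm_sq]
      simp [transition]
      field_simp
    rw [this, im_ofReal_mul]
    ring
  have h2 : (conj (transition p).2 * (fderiv ℝ transition p v).2).im =
      (conj p.2 * v.2).im + 2 * ‖p.2‖ ^ 2 * (v.1 / p.1).im := by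
    have : conj (transition p).2 * (fderiv ℝ transition p v).2 = conj p.2 * v.2 +
        ((‖p.2‖ ^ 2 : ℝ) : ℂ) * (v.1 / p.1 - conj (v.1 / p.1)) := by
      rw [fderiv_transition hp]
      push_cast
      rw [ofReal_norm_sq]
      simp [transition]
      field_simp
    rw [this, add_im, im_ofReal_mul]
    simp only [sub_im, conj_im]
    ring
  have h3 : (conj p.1 * v.1).im = ‖p.1‖ ^ 2 * (v.1 / p.1).im := by
    rw [← im_ofReal_mul]
    push_cast
    rw [ofReal_norm_sq]
    congr 1
    field_simp
  rw [potential_apply, potential_apply, h1, h2, h3, hs, baseCoeff, baseCoeff, fibreCoeff,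
    fibreCoeff, Q_transition κ hp, ← ofReal_sub]
  have h4 : ‖(transition p).1‖ = ‖p.1‖⁻¹ := norm_inv _
  rw [h4]
  congr 1
  generalize (v.1 / p.1).im = x
  generalize (conj p.2 * v.2).im = y
  field_simp
  ring

/-- The first term is `Re(iβ/2)`. The second is the removed form `d arg ζ/(4√κ)`, where `arg ζ = 2
arg den`; a gauge transformation will absorb it. -/
theorem potential_zMap {κ : ℝ} (hκ : 0 < κ) {i : Fin 2} {z : Model} (hz : z ∈ zDomain i)
    (v : Model) : potential κ (zMap i z) (fderiv ℝ (zMap i) z v) =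
      ((-(zdzbar z v).im / (2 * (√(κ + sz z ^ 2) * sz z)) -
        (2 * √κ)⁻¹ * (den i v / den i z).im : ℝ) : ℂ) := by
  have hy : den i z ≠ 0 := mem_zDomain.1 hz
  have hc : conj (den i z) ≠ 0 := by simpa using hy
  have hs := sz_pos (ne_zero_of_mem_zDomain hz)
  have hk : 0 < √κ := Real.sqrt_pos.2 hκ
  have hn : 0 < ‖den i z‖ := norm_pos_iff.2 hy
  have hq : 0 < √(κ + sz z ^ 2) := Real.sqrt_pos.2 (by positivity)
  have hs2 : sz z ^ 2 = √(κ + sz z ^ 2) ^ 2 - √κ ^ 2 := by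
    rw [Real.sq_sqrt (by positivity), Real.sq_sqrt hκ.le]; ring
  obtain ⟨D, hD, hD'⟩ := exists_hasFDerivAt_zMap hz
  have h0 : ‖(zMap i z).1‖ ^ 2 = (sz z - ‖den i z‖ ^ 2) / ‖den i z‖ ^ 2 := by
    rw [zMap_eq, sz_eq i]
    simp [div_pow]
  have h1 : (conj (zMap i z).1 * (D v).1).im =
      (-(zdzbar z v).im - sz z * (den i v / den i z).im) / ‖den i z‖ ^ 2 := by
    have : conj (zMap i z).1 * (D v).1 = (((‖den i z‖ ^ 2)⁻¹ : ℝ) : ℂ) *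
        (conj (zdzbar z v) - (sz z : ℂ) * (den i v / den i z)) := by
      rw [hD', zMap_eq, zdzbar_eq i, ofReal_sz i]
      push_cast
      rw [ofReal_norm_sq]
      simp
      field_simp
      ring
    rw [this, im_ofReal_mul, sub_im, im_ofReal_mul, conj_im]
    ring
  have h2 : (conj (zMap i z).2 * (D v).2).im = 2 * sz z ^ 2 * (den i v / den i z).im := by
    have : conj (zMap i z).2 * (D v).2 = (sz z : ℂ) * (zdzbar z v + conj (zdzbar z v)) +
        ((sz z ^ 2 : ℝ) : ℂ) * (den i v / den i z - conj (den i v / den i z)) := by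
      rw [hD', zMap_eq, zdzbar_eq i]
      push_cast
      simp
      field_simp
      ring
    rw [this, add_im, im_ofReal_mul, im_ofReal_mul]
    simp only [sub_im, add_im, conj_im]
    ring
  rw [potential_apply, hD.fderiv, h1, h2, baseCoeff, fibreCoeff, Q_zMap κ hz, h0]
  have hN : (1 + (sz z - ‖den i z‖ ^ 2) / ‖den i z‖ ^ 2) = sz z / ‖den i z‖ ^ 2 := by
    field_simp
    ring
  rw [hN]
  congr 1
  generalize √(κ + sz z ^ 2) = q at *
  generalize (den i v / den i z).im = x
  generalize (zdzbar z v).im = y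
  rw [hs2]
  field_simp
  ring

/-! ### Phases -/

/-- The phase `(x / |x|) ^ ℓ`. -/
def phase (ℓ : ℤ) (x : ℂ) : ℂ := (x / (‖x‖ : ℂ)) ^ ℓ

theorem norm_phase (ℓ : ℤ) {x : ℂ} (hx : x ≠ 0) : ‖phase ℓ x‖ = 1 := by
  have : ‖x‖ ≠ 0 := norm_ne_zero_iff.2 hx
  simp [phase, this]

theorem contDiffAt_phase (ℓ : ℤ) {x : ℂ} (hx : x ≠ 0) : ContDiffAt ℝ ∞ (phase ℓ) x := by
  have hn : (‖x‖ : ℂ) ≠ 0 := by simpa using hx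
  have h0 : ContDiffAt ℝ ∞ (fun y : ℂ => (‖y‖ : ℂ)) x :=
    ofRealCLM.contDiff.contDiffAt.comp x (contDiffAt_norm ℝ hx)
  have h1 : ContDiffAt ℝ ∞ (fun y : ℂ => y / (‖y‖ : ℂ)) x := by
    simp only [div_eq_mul_inv]
    exact contDiffAt_id.mul (h0.inv hn)
  have h2 : ContDiffAt ℝ ∞ (fun y : ℂ => y ^ ℓ) (x / (‖x‖ : ℂ)) :=
    (analyticAt_id.zpow (div_ne_zero hx hn)).contDiffAt
  exact h2.comp x h1

/-- The logarithmic derivative of `(x/|x|)^ℓ` is `iℓ d arg x`, and `d arg x = Im(dx/x)`. -/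
theorem exists_hasFDerivAt_phase (ℓ : ℤ) {x : ℂ} (hx : x ≠ 0) :
    ∃ f' : ℂ →L[ℝ] ℂ, HasFDerivAt (phase ℓ) f' x ∧
      ∀ v, f' v = phase ℓ x * (ℓ * I * ((v / x).im : ℝ)) := by
  have hc : conj x ≠ 0 := by simpa using hx
  have hn : (‖x‖ : ℂ) ≠ 0 := by simpa using hx
  have hn' : 0 < ‖x‖ := norm_pos_iff.2 hx
  have h0 : HasFDerivAt (fun y : ℂ => ‖y‖)
      (‖x‖⁻¹ • (reCLM ∘L (conj x • ContinuousLinearMap.id ℝ ℂ))) x := by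
    have h := ((hasFDerivAt_id (𝕜 := ℝ) x).norm_sq).sqrt (by simpa using hx)
    have he : (fun y : ℂ => √(‖id y‖ ^ 2)) = fun y => ‖y‖ := by
      ext y; simp
    rw [he] at h
    refine h.congr_fderiv (ContinuousLinearMap.ext fun v => ?_)
    simp [Complex.inner]
    field_simp
  have h1 : HasFDerivAt (fun y : ℂ => ((‖y‖ : ℝ) : ℂ)⁻¹) _ x :=
    ((hasFDerivAt_inv hn).restrictScalars ℝ).comp x (ofRealCLM.hasFDerivAt.comp x h0)
  have h2 : HasFDerivAt (fun y : ℂ => y * ((‖y‖ : ℝ) : ℂ)⁻¹) _ x :=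
    (hasFDerivAt_id (𝕜 := ℝ) x).mul h1
  have hm : x * ((‖x‖ : ℝ) : ℂ)⁻¹ ≠ 0 := mul_ne_zero hx (inv_ne_zero hn)
  have h3 := (hasDerivAt_zpow ℓ _ (Or.inl hm)).comp_hasFDerivAt x h2
  refine ⟨_, h3.congr_of_eventuallyEq (.of_forall fun y => by simp [phase, div_eq_mul_inv]),
    fun v => ?_⟩
  simp only [phase, div_eq_mul_inv x]
  simp only [smul_apply, add_apply, ContinuousLinearMap.comp_apply, ofRealCLM_apply, smul_eq_mul,
    reCLM_apply, ContinuousLinearMap.coe_restrictScalars', ContinuousLinearMap.id_apply, id_eq,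
    ContinuousLinearMap.toSpanSingleton_apply, zpow_sub_one₀ hm]
  generalize (x * ((‖x‖ : ℝ) : ℂ)⁻¹) ^ ℓ = y
  push_cast
  rw [im_eq_sub_conj, re_eq_add_conj]
  simp only [map_mul, map_div₀, conj_conj]
  have hxx := ofReal_norm_sq x
  field_simp
  rw [hxx]
  ring

/-! ### The connections -/

theorem exists_hasFDerivAt_phase_comp (ℓ : ℤ) (α : Covector) {p : Model} (hp : α p ≠ 0) :
    ∃ f' : Covector, HasFDerivAt (fun q => phase ℓ (α q)) f' p ∧
      ∀ v, (phase ℓ (α p))⁻¹ * f' v = ℓ * I * ((α v / α p).im : ℝ) := by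
  obtain ⟨f', hf, hf'⟩ := exists_hasFDerivAt_phase ℓ hp
  refine ⟨_, hf.comp p α.hasFDerivAt, fun v => ?_⟩
  have h0 : phase ℓ (α p) ≠ 0 := norm_ne_zero_iff.1 (by rw [norm_phase ℓ hp]; exact one_ne_zero)
  rw [ContinuousLinearMap.comp_apply, hf', inv_mul_cancel_left₀ h0]

theorem contDiffOn_phase_comp (ℓ : ℤ) (α : Covector) :
    ContDiffOn ℝ ∞ (fun q => phase ℓ (α q)) {p | α p ≠ 0} := fun _ hp =>
  ((contDiffAt_phase ℓ hp).comp _ α.contDiff.contDiffAt).contDiffWithinAt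

/-- The connection with potentials `-2 i ℓ √κ` times `potential κ`, on the line bundle with
transition function `(w / |w|) ^ ℓ`. -/
def connection {κ : ℝ} (hκ : 0 < κ) (ℓ : ℤ) : U1Connection where
  pot _ p := (-2 * I * ℓ * √κ) • potential κ p
  h p := phase ℓ p.1
  pot_smooth _ := (contDiff_potential hκ).const_smul _
  pot_imag _ p v := by
    rw [smul_apply, potential_apply, smul_eq_mul,
      show -2 * I * ℓ * √κ = ((-2 * ℓ * √κ : ℝ) : ℂ) * I by push_cast; ring, mul_right_comm,
      ← ofReal_mul, re_ofReal_mul, I_re, mul_zero]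
  h_smooth := contDiffOn_phase_comp ℓ (ContinuousLinearMap.fst ℝ ℂ ℂ)
  h_unit p hp := norm_phase ℓ hp
  compat p hp := by
    have hk : (√κ : ℂ) ≠ 0 := by exact_mod_cast (Real.sqrt_pos.2 hκ).ne'
    obtain ⟨f', hf, hf'⟩ :=
      exists_hasFDerivAt_phase_comp ℓ (ContinuousLinearMap.fst ℝ ℂ ℂ) (p := p) hp
    refine ContinuousLinearMap.ext fun v => ?_
    have hv := hf' v
    simp only [ContinuousLinearMap.coe_fst'] at hf hv
    rw [hf.fderiv, ContinuousLinearMap.comp_apply, smul_apply, potential_transition hκ hp,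
      add_apply, smul_apply, smul_apply, smul_eq_mul, smul_eq_mul, smul_eq_mul, hv]
    push_cast
    field_simp
    ring

theorem connection_hasCurvature {κ : ℝ} (hκ : 0 < κ) (ℓ : ℤ) :
    (connection hκ ℓ).HasCurvature (curvatureForm hκ (ℓ * √κ / 2)) := fun i p => by
  change d₁ (fun p => _ • potential κ p) p = (-4 * I * (ℓ * √κ / 2)) • omegaTilde κ i p
  rw [d₁_const_smul _ ((contDiff_potential hκ).differentiable (by simp) p), d₁_potential hκ i]
  congr 1
  ring

theorem connection_hasZPotential {κ : ℝ} (hκ : 0 < κ) (ℓ : ℤ) :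
    (connection hκ ℓ).HasZPotential fun z => (ℓ : ℂ) • (A κ z - conjForm (A κ z)) := by
  have hk : (√κ : ℂ) ≠ 0 := by exact_mod_cast (Real.sqrt_pos.2 hκ).ne'
  -- The gauge `(den/|den|)^ℓ` cancels the `d arg den` term of `potential_zMap`. The two gauges
  -- differ by `(w/|w|)^ℓ` because `w = z₁/z₂`.
  refine ⟨fun i z => phase ℓ (den i z), fun i => ?_, fun i z hz => norm_phase ℓ (mem_zDomain.1 hz),
    fun z hz => ?_, fun i z hz => ?_⟩
  · have : zDomain i = {z | den i z ≠ 0} := by ext; exact mem_zDomain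
    rw [this]
    exact contDiffOn_phase_comp ℓ (den i)
  · have h1 : z.1 ≠ 0 := hz.2
    have h2 : z.2 ≠ 0 := hz.1
    have n1 : (‖z.1‖ : ℂ) ≠ 0 := by simpa using h1
    have n2 : (‖z.2‖ : ℂ) ≠ 0 := by simpa using h2
    change phase ℓ z.1 = phase ℓ z.2 * phase ℓ (z.1 / z.2)
    rw [phase, phase, phase, ← mul_zpow, norm_div]
    congr 1
    push_cast
    field_simp
  · have hs := sz_pos (ne_zero_of_mem_zDomain hz)
    have hs' : (sz z : ℂ) ≠ 0 := by exact_mod_cast hs.ne'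
    have hq : (√(κ + sz z ^ 2) : ℂ) ≠ 0 := by
      exact_mod_cast (Real.sqrt_pos.2 (by positivity : 0 < κ + sz z ^ 2)).ne'
    obtain ⟨f', hf, hf'⟩ := exists_hasFDerivAt_phase_comp ℓ (den i) (mem_zDomain.1 hz)
    refine ContinuousLinearMap.ext fun v => ?_
    have hA := congrArg (fun α : Covector => α v) (smul_A_sub_conj κ ℓ z)
    simp only [add_apply, hf.fderiv, ContinuousLinearMap.comp_apply, hA]
    change (-2 * I * ℓ * √κ) * potential κ (zMap i z) (fderiv ℝ (zMap i) z v) =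
      (ℓ * (√κ / 2)) * (β κ z v - conj (β κ z v)) + (phase ℓ (den i z))⁻¹ * f' v
    rw [hf', potential_zMap hκ hz, β, F, F_mul_sq κ hs, smul_apply, smul_eq_mul, map_mul,
      conj_ofReal, ← mul_sub, sub_conj]
    push_cast
    field_simp
    ring

/-! ### Integrality of the flux -/

theorem exists_hasFDerivAt_of_d₁_eq_zero {α : Model → Covector} (hα : Differentiable ℝ α)
    (h : ∀ p, d₁ α p = 0) : ∃ f : Model → ℂ, ∀ p, HasFDerivAt f (α p) p := by
  obtain ⟨f, hf⟩ := convex_univ.exists_forall_hasFDerivAt_of_fderiv_symmetric isOpen_univ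
    hα.differentiableOn fun p _ u v => by
      have h1 := d₁_apply (hα p) u v
      rw [h p] at h1
      exact (sub_eq_zero.1 h1.symm)
  exact ⟨f, fun p => hf p trivial⟩

theorem differentiableAt_transition {p : Model} (hp : p.1 ≠ 0) :
    DifferentiableAt ℝ transition p := by
  have hc : conj p.1 ≠ 0 := by simpa using hp
  have h1 : DifferentiableAt ℝ (fun q : Model => conj q.1) p :=
    (hasFDerivAt_conj_comp (ContinuousLinearMap.fst ℝ ℂ ℂ) p).differentiableAt
  have h2 : DifferentiableAt ℝ (fun q : Model => q.1) p := differentiableAt_fst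
  have h3 : DifferentiableAt ℝ (fun q : Model => q.2) p := differentiableAt_snd
  have ht : transition = fun q : Model => ((q.1)⁻¹, q.2 * (q.1 * (conj q.1)⁻¹)) := by
    ext1 q; simp [transition, div_eq_mul_inv]
  rw [ht]
  exact (h2.inv hp).prodMk (h3.mul (h2.mul (h1.inv hc)))

/-- Over each chart the given potential differs from `-4ic · potential` by an exact form `df i`.
Hence on the overlap `h⁻¹ dh = (2ic/√κ) d arg w + d(f 1 ∘ transition - f 0)`, and single-valuedness
of `h` around `w = 0` makes `2c/√κ` an integer. -/
theorem U1Connection.exists_flux_eq {κ : ℝ} (hκ : 0 < κ) {c : ℂ} {C : U1Connection}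
    (hC : C.HasCurvature (curvatureForm hκ c)) : ∃ ℓ : ℤ, 2 * c / √κ = ℓ := by
  have hk : (√κ : ℂ) ≠ 0 := by exact_mod_cast (Real.sqrt_pos.2 hκ).ne'
  have hpi : (Real.pi : ℂ) ≠ 0 := by exact_mod_cast Real.pi_ne_zero
  have hpot : Differentiable ℝ (potential κ) := (contDiff_potential hκ).differentiable (by simp)
  have hex : ∀ i, ∃ f : Model → ℂ, ∀ p,
      HasFDerivAt f (C.pot i p - (-4 * I * c) • potential κ p) p := fun i => by
    have h1 : Differentiable ℝ (C.pot i) := (C.pot_smooth i).differentiable (by simp)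
    have h2 : Differentiable ℝ fun p => (-4 * I * c) • potential κ p := hpot.fun_const_smul _
    refine exists_hasFDerivAt_of_d₁_eq_zero (h1.fun_sub h2) fun p => ?_
    rw [d₁_sub (h1 p) (h2 p), hC i p,
      d₁_const_smul _ (hpot p), d₁_potential hκ i]
    exact sub_self _
  choose f hf using hex
  -- The equator of the zero section, which lies in the overlap and generates the winding in `w`.
  let γ : ℝ → Model := fun t => (exp (t * I), 0)
  have hγ0 : ∀ t, (γ t).1 ≠ 0 := fun t => exp_ne_zero _
  have hγ : ∀ t : ℝ, HasDerivAt γ (exp (t * I) * I, 0) t := fun t => by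
    have h1 : HasDerivAt (fun t : ℝ => exp (t * I)) (exp (t * I) * I) t := by
      simpa using ((ofRealCLM.hasDerivAt (x := t)).mul_const I).cexp
    exact h1.prodMk (hasDerivAt_const t 0)
  have hper : γ (2 * Real.pi) = γ 0 := by
    simp only [γ]
    push_cast
    rw [exp_two_pi_mul_I]
    simp
  have hh : ∀ t, HasFDerivAt C.h (fderiv ℝ C.h (γ t)) (γ t) := fun t => by
    have ho : IsOpen {p : Model | p.1 ≠ 0} := isOpen_ne_fun continuous_fst continuous_const
    exact (((C.h_smooth _ (hγ0 t)).contDiffAt (ho.mem_nhds (hγ0 t))).differentiableAt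
      (by simp)).hasFDerivAt
  have hh0 : ∀ t, C.h (γ t) ≠ 0 := fun t =>
    norm_ne_zero_iff.1 (by rw [C.h_unit _ (hγ0 t)]; exact one_ne_zero)
  let φ : ℝ → ℂ := fun t => f 1 (transition (γ t)) - f 0 (γ t)
  -- Integrating `h⁻¹ dh` along the loop without a logarithm: `h` divided by the exponential of the
  -- expected primitive is constant.
  have hH : ∀ t : ℝ,
      HasDerivAt (fun t : ℝ => C.h (γ t) * exp (-(2 * c / √κ * I * t + φ t))) 0 t := by
    intro t
    have h1 := (hh t).comp_hasDerivAt t (hγ t)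
    have h2 := (hf 0 (γ t)).comp_hasDerivAt t (hγ t)
    have h3 := ((hf 1 (transition (γ t))).comp (γ t)
      (differentiableAt_transition (hγ0 t)).hasFDerivAt).comp_hasDerivAt t (hγ t)
    have h4 := ((ofRealCLM.hasDerivAt (x := t)).const_mul (2 * c / √κ * I))
    have h5 := h1.mul ((h4.add (h3.sub h2)).neg.cexp)
    refine h5.congr_deriv ?_
    have h6 := congrArg (fun α : Covector => α (exp (t * I) * I, 0)) (C.compat (γ t) (hγ0 t))
    simp only [ContinuousLinearMap.comp_apply, add_apply, smul_apply, smul_eq_mul] at h6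
    have h7 := potential_transition hκ (hγ0 t) (exp (t * I) * I, 0)
    have h8 : (exp (t * I) * I / (γ t).1).im = 1 := by
      change (exp (t * I) * I / exp (t * I)).im = 1
      rw [mul_div_cancel_left₀ _ (exp_ne_zero _), I_im]
    simp only [h8] at h7
    simp only [ContinuousLinearMap.comp_apply, sub_apply, smul_apply, smul_eq_mul, h6, h7,
      Function.comp_apply, ofRealCLM_apply]
    have h9 := hh0 t
    push_cast
    field_simp
    ring
  have hconst := is_const_of_deriv_eq_zero (fun t => (hH t).differentiableAt)
    (fun t => (hH t).deriv) (2 * Real.pi) 0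
  simp only [hper, φ] at hconst
  -- After one turn `h` and `φ` return to their values, so only the factor `exp(-2πi · 2c/√κ)`
  -- remains, and it must be 1.
  have h1 := mul_left_cancel₀ (hh0 0) hconst
  rw [exp_eq_exp_iff_exists_int] at h1
  obtain ⟨n, hn⟩ := h1
  refine ⟨-n, ?_⟩
  push_cast at hn ⊢
  have h2 : (2 * Real.pi * I) * (2 * c / √κ) = (2 * Real.pi * I) * (-n) := by
    linear_combination -hn
  exact mul_left_cancel₀ (by simp [hpi]) h2

theorem exists_hasCurvature_iff {κ : ℝ} (hκ : 0 < κ) (c : ℂ) :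
    (∃ C : U1Connection, C.HasCurvature (curvatureForm hκ c)) ↔
      ∃ ℓ : ℤ, I / (2 * Real.pi) * (curvatureForm hκ c).flux = ℓ := by
  have hk : (√κ : ℂ) ≠ 0 := by exact_mod_cast (Real.sqrt_pos.2 hκ).ne'
  rw [flux_curvatureForm_div]
  constructor
  · rintro ⟨C, hC⟩
    exact U1Connection.exists_flux_eq hκ hC
  · rintro ⟨ℓ, h⟩
    refine ⟨connection hκ ℓ, ?_⟩
    have hc : c = ℓ * √κ / 2 := by rw [← h]; field_simp
    rw [hc]
    exact connection_hasCurvature hκ ℓ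

/-! ### The `∂̄`-potential of `A` -/

/-- The function depends on `s` only, and `zdzbar` is the conjugate-linear part of `ds`, so `∂̄`
keeps just the `zdzbar` term of the chain rule. -/
theorem A_eq_dbar {κ : ℝ} (hκ : 0 < κ) {z : Model} (hz : z ≠ 0) :
    A κ z = (-1 / 2 : ℂ) • dbar (fun z => (Real.arsinh (√κ / sz z) : ℂ)) z := by
  have hs := sz_pos hz
  have hF : 0 < √(1 + κ / sz z ^ 2) := Real.sqrt_pos.2 (by positivity)
  have h1 := ((hasDerivAt_inv hs.ne').const_mul (√κ)).comp_hasFDerivAt z (hasFDerivAt_sz z)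
  have h2 : HasFDerivAt (fun q => (Real.arsinh (√κ / sz q) : ℂ)) _ z :=
    ofRealCLM.hasFDerivAt.comp z h1.arsinh
  have h3 : ∀ v, fderiv ℝ (fun q => (Real.arsinh (√κ / sz q) : ℂ)) z v =
      ((-(√κ / (sz z ^ 2 * F κ z)) : ℝ) : ℂ) * (zdzbar z v + conj (zdzbar z v)) := fun v => by
    rw [h2.fderiv]
    simp only [ContinuousLinearMap.comp_apply, ofRealCLM_apply, smul_apply, add_apply, smul_eq_mul,
      reCLM_apply, ContinuousLinearMap.coe_fst', ContinuousLinearMap.coe_snd']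
    have h4 : 1 + ((fun y => √κ * y⁻¹) ∘ sz) z ^ 2 = 1 + κ / sz z ^ 2 := by
      simp only [Function.comp_apply]
      rw [mul_pow, Real.sq_sqrt hκ.le, inv_pow, div_eq_mul_inv]
    have h5 : (zdzbar z v + conj (zdzbar z v)) =
        ((2 * (conj z.1 * v.1).re + 2 * (conj z.2 * v.2).re : ℝ) : ℂ) := by
      rw [add_conj, zdzbar_apply]
      simp
      ring
    rw [h4, h5, F, ← ofReal_mul]
    congr 1
    field_simp
  refine ContinuousLinearMap.ext fun v => ?_
  have h4 : zdzbar z (I • v) = -I * zdzbar z v := by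
    simp [zdzbar_apply]
    ring
  have h5 : conj (zdzbar z (I • v)) = I * conj (zdzbar z v) := by
    rw [h4]
    simp
  rw [A, dbar]
  simp only [smul_apply, add_apply, ContinuousLinearMap.comp_apply, smul_eq_mul,
    ContinuousLinearMap.coe_restrictScalars', ContinuousLinearMap.id_apply, h3, h5]
  rw [h4]
  push_cast
  have hF' : (F κ z : ℂ) ≠ 0 := by exact_mod_cast hF.ne'
  have hs' : (sz z : ℂ) ≠ 0 := by exact_mod_cast hs.ne'
  field_simp
  rw [I_sq]
  ring

end EguchiHanson

end

open EguchiHanson in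
theorem mainTheorem4 (κ : ℝ) (hκ : 0 < κ) :
    -- the form `ω̃`
    (∃ om : Form 2, (∀ i p, om.expr i p = omegaTilde κ i p) ∧
      om.IsClosed ∧ om.IsAntiSelfDual κ ∧ om.IsL2 κ ∧
      (∀ i p, HasNormSq κ p (om.expr i p) (2 * (sF κ (chart i p) ^ 4)⁻¹)) ∧
      om.HasZExpr (fun z => (I / 2) • d₁ (β κ) z) ∧
      -- the multiples `c (β - β̄)` and the quantisation of their flux
      ∀ c : ℂ, ∃ Ω : Form 2,
        Ω.HasZExpr (d₁ fun z => c • (β κ z - conjForm (β κ z))) ∧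
        (∀ Ω' : Form 2, Ω'.HasZExpr (d₁ fun z => c • (β κ z - conjForm (β κ z))) → Ω' = Ω) ∧
        (∀ i p, Ω.expr i p = (-4 * I * c) • om.expr i p) ∧
        (∀ ℓ : ℤ, I / (2 * Real.pi) * Ω.flux = ℓ ↔
          ∀ z : Model, z ≠ 0 →
            c • (β κ z - conjForm (β κ z)) = (ℓ : ℂ) • (A κ z - conjForm (A κ z))) ∧
        ((∃ C : U1Connection, C.HasCurvature Ω) ↔
          ∃ ℓ : ℤ, I / (2 * Real.pi) * Ω.flux = ℓ)) ∧
    -- the resulting `U(1)` connections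
    (∀ ℓ : ℤ, ∃ C : U1Connection,
      C.HasZPotential fun z => (ℓ : ℂ) • (A κ z - conjForm (A κ z))) ∧
    ∀ z : Model, z ≠ 0 →
      A κ z = (-1 / 2 : ℂ) • dbar (fun z => (Real.arsinh (√κ / sz z) : ℂ)) z :=
  ⟨⟨omegaForm hκ, fun _ _ => rfl, omegaForm_isClosed hκ, omegaForm_isAntiSelfDual hκ,
    omegaForm_isL2 hκ, hasNormSq_omegaTilde hκ, omegaForm_hasZExpr hκ, fun c =>
      ⟨curvatureForm hκ c, curvatureForm_hasZExpr hκ c,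
        fun _ h => Form.eq_of_hasZExpr h (curvatureForm_hasZExpr hκ c), fun _ _ => rfl,
        fun ℓ => flux_eq_iff hκ c ℓ, exists_hasCurvature_iff hκ c⟩⟩,
    fun ℓ => ⟨connection hκ ℓ, connection_hasZPotential hκ ℓ⟩, fun _ hz => A_eq_dbar hκ hz⟩
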